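/- Let $G$ be a (non-compact) real semisimple Lie group with Lie algebra $\mathfrak g$ and Killing form $\kappa$. Fix a Cartan involution $\theta$, with $+1$ and $-1$ eigenspaces $\mathfrak k$ and $\mathfrak s$, a maximal abelian subspace $\mathfrak a\subset\mathfrak s$, the set $\Delta\subset\mathfrak a^*$ of restricted roots with root spaces $\mathfrak g_\alpha=\{X\in\mathfrak g:\ [H,X]=\alpha(H)X\ \ \forall H\in\mathfrak a\}$, and a positive system $\Delta^+\subset\Delta$. Put $\mathfrak a_{++}=\{A\in\mathfrak a:\ \alpha(A)\ge 0\ \ \forall\alpha\in\Delta^+\}$, $\mathfrak n^+=\sum_{\alpha\in\Delta^+}\mathfrak g_\alpha$, and $\mathfrak m=\{X\in\mathfrak k:\ [H,X]=0\ \ \forall H\in\mathfrak a\}$. Let $\mathcal C\subset\mathfrak a$ be a set on which every root is identically zero, everywhere positive, or everywhere negative. Let $\Delta^0(\mathcal C)$ and $\Delta^+(\mathcal C)$ be the sets of roots that vanish, respectively are positive, on $\mathcal C$, and put $$\mathfrak p_{\mathcal C}=\mathfrak m+\mathfrak a+\sum_{\alpha\in\Delta^0(\mathcal C)\cup\Delta^+(\mathcal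 C)}\mathfrak g_\alpha,\qquad P_{\mathcal C}=N_G(\mathfrak p_{\mathcal C})=\{g\in G:\ \mathrm{Ad}(g)\mathfrak p_{\mathcal C}=\mathfrak p_{\mathcal C}\},\qquad F=G/P_{\mathcal C}.$$ The flag manifold $F$ carries its smooth structure of homogeneous space (the one for which $G\to F$ is a smooth submersion) and any smooth Riemannian metric. For $A\in\mathfrak a$ let $\phi^A_t(x)=e^{tA}x$ on $F$, and let $$\tilde\phi^A_t(x,\xi)=\Big(\phi^A_t(x),\ \frac{\xi\circ (d_x\phi^A_t)^{-1}}{|\xi\circ (d_x\phi^A_t)^{-1}|}\Big)$$ be the induced flow on the co-sphere bundle $S^*F=\{(x,\xi)\in T^*F:\ |\xi|=1\}$. Let $E_u(x)=\mathfrak n^+x=\{\frac{d}{dt}|_{t=0}e^{tY}x:\ Y\in\mathfrak n^+\}\subset T_xF$ be the tangent space at $x$ of the unstable manifold $\exp(\mathfrak n^+)x$, let $E_u^*(x)=\{\xi\in T^*_xF:\ \xi|_{E_u(x)}=0\}$, and let $\Sigma_s=S^*F\cap E_u^*$. Then for every open set $V^s_0\subset S^*F$ with $\Sigma_s\subset V_0^s$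 there is an open set $V^s\subset S^*F$ with $\Sigma_s\subset V^s\subset V_0^s$ that is positively invariant under all the flows simultaneously: $\tilde\phi^A_t(V^s)\subset V^s$ for all $A\in\mathfrak a_{++}$ and all $t\ge 0$. -/

import Mathlib

open scoped Manifold ContDiff Bundle

noncomputable section

/-! ### Restricted roots and parabolic subalgebras of a real Lie algebra -/

section LieAlgebraPart

variable {L : Type*} [LieRing L] [LieAlgebra ℝ L]

/-- The standard choices made in a real semisimple Lie algebra `L`: a Cartan involution `θ`
(an involutive automorphism for which `-κ(X, θ Y)` is positive definite, `κ` the Killing form),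
a maximal abelian subspace `𝔞` of the `-1` eigenspace of `θ`, and a Weyl chamber of `𝔞`, i.e.
the set `posRoots` of restricted roots that are positive on some regular element of `𝔞`. -/
structure IwasawaData (L : Type*) [LieRing L] [LieAlgebra ℝ L] where
  /-- the Cartan involution -/
  θ : L ≃ₗ⁅ℝ⁆ L
  θ_involutive : ∀ X, θ (θ X) = X
  θ_pos : ∀ X, X ≠ 0 → 0 < -(killingForm ℝ L X (θ X))
  /-- the (split) Cartan subalgebra -/
  𝔞 : Submodule ℝ L
  𝔞_maximal : Maximal
    (fun 𝔟 : Submodule ℝ L => (∀ X ∈ 𝔟, θ X = -X) ∧ ∀ X ∈ 𝔟, ∀ Y ∈ 𝔟, ⁅X, Y⁆ = 0) 𝔞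
  /-- the positive restricted roots `Δ⁺` -/
  posRoots : Set (Module.Dual ℝ 𝔞)
  posRoots_eq : ∃ H₀ : 𝔞,
    (∀ α : Module.Dual ℝ 𝔞,
      (α ≠ 0 ∧ ∃ X : L, X ≠ 0 ∧ ∀ H : 𝔞, ⁅(H : L), X⁆ = α H • X) → α H₀ ≠ 0) ∧
    posRoots = {α | (α ≠ 0 ∧ ∃ X : L, X ≠ 0 ∧ ∀ H : 𝔞, ⁅(H : L), X⁆ = α H • X) ∧ 0 < α H₀}

namespace IwasawaData

variable (D : IwasawaData L)

/-- The joint eigenspace `𝔤_α = {X | [H, X] = α(H) X for all H ∈ 𝔞}`. -/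
def rootSpace (α : Module.Dual ℝ D.𝔞) : Submodule ℝ L where
  carrier := {X | ∀ H : D.𝔞, ⁅(H : L), X⁆ = α H • X}
  add_mem' := by
    intro X Y hX hY H
    rw [lie_add, hX H, hY H, smul_add]
  zero_mem' := by
    intro H
    simp
  smul_mem' := by
    intro c X hX H
    rw [lie_smul, hX H, smul_comm]

/-- The set `Δ` of restricted roots. -/
def roots : Set (Module.Dual ℝ D.𝔞) :=
  {α | α ≠ 0 ∧ D.rootSpace α ≠ ⊥}

/-- The positive Weyl chamber `𝔞₊₊ = {A ∈ 𝔞 | α(A) ≥ 0 for all α ∈ Δ⁺}`. -/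
def weylChamber : Set D.𝔞 :=
  {A | ∀ α ∈ D.posRoots, 0 ≤ α A}

/-- `𝔫⁺`, the sum of the positive root spaces. -/
def nPlus : Submodule ℝ L :=
  ⨆ α ∈ D.posRoots, D.rootSpace α

/-- `𝔪`, the centralizer of `𝔞` in the fixed space `𝔨` of `θ`. -/
def 𝔪 : Submodule ℝ L where
  carrier := {X | D.θ X = X ∧ ∀ H : D.𝔞, ⁅(H : L), X⁆ = 0}
  add_mem' := by
    rintro X Y ⟨hX, hX'⟩ ⟨hY, hY'⟩
    exact ⟨by rw [map_add, hX, hY], fun H => by rw [lie_add, hX' H, hY' H, add_zero]⟩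
  zero_mem' := ⟨map_zero _, fun H => lie_zero _⟩
  smul_mem' := by
    rintro c X ⟨hX, hX'⟩
    exact ⟨by rw [map_smul, hX], fun H => by rw [lie_smul, hX' H, smul_zero]⟩

/-- `Δ⁰(C)`: the roots vanishing on `C`. -/
def rootsZero (C : Set D.𝔞) : Set (Module.Dual ℝ D.𝔞) :=
  {α | α ∈ D.roots ∧ ∀ H ∈ C, α H = 0}

/-- `Δ⁺(C)`: the roots that are positive on `C`. -/
def rootsPos (C : Set D.𝔞) : Set (Module.Dual ℝ D.𝔞) :=
  {α | α ∈ D.roots ∧ ∀ H ∈ C, 0 < α H}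

/-- `Δ⁻(C)`: the roots that are negative on `C`. -/
def rootsNeg (C : Set D.𝔞) : Set (Module.Dual ℝ D.𝔞) :=
  {α | α ∈ D.roots ∧ ∀ H ∈ C, 0 < -α H}

/-- The parabolic subalgebra `𝔭_C = 𝔪 + 𝔞 + ∑_{α ∈ Δ⁰(C) ∪ Δ⁺(C)} 𝔤_α`. -/
def parabolic (C : Set D.𝔞) : Submodule ℝ L :=
  D.𝔪 ⊔ D.𝔞 ⊔ ⨆ α ∈ D.rootsZero C ∪ D.rootsPos C, D.rootSpace α

end IwasawaData

end LieAlgebraPart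

/-! ### Adjoint representation and exponential map of a Lie group -/

section LieGroupPart

variable {E : Type*} [NormedAddCommGroup E] [NormedSpace ℝ E]
  {G : Type*} [TopologicalSpace G] [ChartedSpace E G] [Group G]

/-- `Ad g`: the derivative at `1` of the conjugation `x ↦ g x g⁻¹`. -/
def lieAd (g : G) : GroupLieAlgebra 𝓘(ℝ, E) G →ₗ[ℝ] GroupLieAlgebra 𝓘(ℝ, E) G :=
  (mfderiv 𝓘(ℝ, E) 𝓘(ℝ, E) (fun x : G => g * x * g⁻¹) 1 : E →L[ℝ] E).toLinearMap

/-- `γ` is a one-parameter subgroup of `G` with velocity `A` at time `0`. -/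
def IsOneParameterSubgroup (A : GroupLieAlgebra 𝓘(ℝ, E) G) (γ : ℝ → G) : Prop :=
  ContMDiff 𝓘(ℝ, ℝ) 𝓘(ℝ, E) ∞ γ ∧ γ 0 = 1 ∧ (∀ s t, γ (s + t) = γ s * γ t) ∧
    (mfderiv 𝓘(ℝ, ℝ) 𝓘(ℝ, E) γ 0 : ℝ →L[ℝ] E) 1 = A

open Classical in
/-- The exponential map: `exp A = γ 1`, where `γ` is the (unique) one-parameter subgroup with
velocity `A`. -/
def lieExp (A : GroupLieAlgebra 𝓘(ℝ, E) G) : G :=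
  if h : ∃ γ : ℝ → G, IsOneParameterSubgroup A γ then h.choose 1 else 1

theorem lieAd_one : lieAd (E := E) (1 : G) = LinearMap.id := by
  have h : (fun x : G => 1 * x * (1 : G)⁻¹) = id := by
    funext x
    simp
  unfold lieAd
  rw [h, mfderiv_id]
  rfl

variable [LieGroup 𝓘(ℝ, E) ∞ G]

/-- A smooth Lie group has the regularity under which Mathlib defines the Lie bracket on
`GroupLieAlgebra`. -/
instance instLieGroupMinSmoothness : LieGroup 𝓘(ℝ, E) (minSmoothness ℝ 3) G :=
  LieGroup.of_le (n := ∞) (by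
    rw [minSmoothness_of_isRCLikeNormedField]
    exact ENat.LEInfty.out)

theorem contMDiff_conj (g : G) :
    ContMDiff 𝓘(ℝ, E) 𝓘(ℝ, E) ∞ (fun x : G => g * x * g⁻¹) :=
  (contMDiff_const.mul contMDiff_id).mul contMDiff_const

theorem lieAd_mul (g h : G) : lieAd (E := E) (g * h) = lieAd g ∘ₗ lieAd h := by
  have hfun : (fun x : G => g * h * x * (g * h)⁻¹)
      = (fun x : G => g * x * g⁻¹) ∘ (fun x : G => h * x * h⁻¹) := by
    funext x
    simp [mul_assoc]
  have hd : ∀ k y : G, MDifferentiableAt 𝓘(ℝ, E) 𝓘(ℝ, E) (fun x : G => k * x * k⁻¹) y :=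
    fun k y => (contMDiff_conj k).mdifferentiableAt (by simp)
  have hc := mfderiv_comp (I := 𝓘(ℝ, E)) (I' := 𝓘(ℝ, E)) (I'' := 𝓘(ℝ, E)) (1 : G)
    (hd g (h * 1 * h⁻¹)) (hd h 1)
  have h1 : h * 1 * h⁻¹ = 1 := by simp
  ext X
  change (mfderiv 𝓘(ℝ, E) 𝓘(ℝ, E) (fun x : G => g * h * x * (g * h)⁻¹) 1 : E →L[ℝ] E) X =
    (mfderiv 𝓘(ℝ, E) 𝓘(ℝ, E) (fun x : G => g * x * g⁻¹) 1 : E →L[ℝ] E)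
      ((mfderiv 𝓘(ℝ, E) 𝓘(ℝ, E) (fun x : G => h * x * h⁻¹) 1 : E →L[ℝ] E) X)
  rw [hfun, hc, h1]
  rfl

/-- The normalizer `N_G(𝔭) = {g | Ad(g) 𝔭 = 𝔭}` of a subspace `𝔭` of the Lie algebra. -/
def adNormalizer (𝔭 : Submodule ℝ (GroupLieAlgebra 𝓘(ℝ, E) G)) : Subgroup G where
  carrier := {g | 𝔭.map (lieAd g) = 𝔭}
  one_mem' := by
    change 𝔭.map (lieAd 1) = 𝔭
    rw [lieAd_one, Submodule.map_id]
  mul_mem' := by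
    intro g h hg hh
    change 𝔭.map (lieAd (g * h)) = 𝔭
    rw [lieAd_mul, Submodule.map_comp]
    change 𝔭.map (lieAd g) = 𝔭 at hg
    change 𝔭.map (lieAd h) = 𝔭 at hh
    rw [hh, hg]
  inv_mem' := by
    intro g hg
    change 𝔭.map (lieAd g⁻¹) = 𝔭
    change 𝔭.map (lieAd g) = 𝔭 at hg
    conv_lhs => rw [← hg]
    rw [← Submodule.map_comp, ← lieAd_mul, inv_mul_cancel, lieAd_one, Submodule.map_id]

end LieGroupPart

/-! ### The co-sphere bundle and the lifted action -/

section Cosphere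

variable {E : Type*} [NormedAddCommGroup E] [NormedSpace ℝ E]
  {G : Type*} [TopologicalSpace G] [ChartedSpace E G] [Group G]
  {V : Type*} [NormedAddCommGroup V] [NormedSpace ℝ V]

/-- The cotangent bundle `T*M`, with Mathlib's bundle topology. -/
abbrev CotangentBundle (V : Type*) [NormedAddCommGroup V] [NormedSpace ℝ V]
    (M : Type*) [TopologicalSpace M] [ChartedSpace V M] : Type _ :=
  Bundle.TotalSpace (V →L[ℝ] ℝ) (fun x : M => TangentSpace 𝓘(ℝ, V) x →L[ℝ] ℝ)

variable {M : Type*} [TopologicalSpace M] [ChartedSpace V M] [MulAction G M]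

/-- The map `Y ↦ X_Y(x)`, where `X_Y(x) = (d/dt) exp(tY) x` at `t = 0` is the value at `x` of the
vector field generated by `Y`: the derivative at `1` of the orbit map `g ↦ g x`. -/
def fundamentalField (x : M) : GroupLieAlgebra 𝓘(ℝ, E) G →ₗ[ℝ] TangentSpace 𝓘(ℝ, V) x :=
  (mfderiv 𝓘(ℝ, E) 𝓘(ℝ, V) (fun g : G => g • x) 1 : E →L[ℝ] V).toLinearMap

/-- The natural lift to the cotangent bundle of the action of `g` :
`(x, ξ) ↦ (g x, ξ ∘ (d_x g)⁻¹)`. -/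
def cotangentLift (g : G) (p : CotangentBundle V M) : CotangentBundle V M :=
  ⟨g • p.1, p.2.comp (mfderiv 𝓘(ℝ, V) 𝓘(ℝ, V) (fun y : M => g • y) p.1).inverse⟩

variable [Bundle.RiemannianBundle (fun x : M => TangentSpace 𝓘(ℝ, V) x)]

variable (V M) in
/-- The co-sphere bundle `S*M = {(x, ξ) | |ξ| = 1}`, for the norm dual to the Riemannian metric. -/
def cosphereBundle : Set (CotangentBundle V M) := {p | ‖p.2‖ = 1}

/-- The lift of the action of `g` to the co-sphere bundle:
`(x, ξ) ↦ (g x, g ξ / |g ξ|)`. -/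
def cosphereLift (g : G) (p : CotangentBundle V M) : CotangentBundle V M :=
  ⟨(cotangentLift g p).1, ‖(cotangentLift g p).2‖⁻¹ • (cotangentLift g p).2⟩

end Cosphere

/-! ### Flag manifolds and their flows -/

section Flag

variable {E : Type*} [NormedAddCommGroup E] [NormedSpace ℝ E] [CompleteSpace E]
  {G : Type*} [TopologicalSpace G] [ChartedSpace E G] [Group G] [LieGroup 𝓘(ℝ, E) ∞ G]
  {V : Type*} [NormedAddCommGroup V] [NormedSpace ℝ V]
  (D : IwasawaData (GroupLieAlgebra 𝓘(ℝ, E) G))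

/-- The flag manifold `F_C = G / P_C`, where `P_C = N_G(𝔭_C)`. -/
abbrev FlagManifold (C : Set D.𝔞) : Type _ :=
  G ⧸ adNormalizer (D.parabolic C)

section
variable {M : Type*} [TopologicalSpace M] [ChartedSpace V M] [MulAction G M]

/-- The unstable space `E_u(x) = T_x W^u(x⁻) = 𝔫⁺ x`. Here `W^u(wP) = exp(𝔫⁺) wP`, so that
`W^u(x⁻)` is the orbit of `x` under `exp(𝔫⁺)`: for `A` inside the positive chamber,
`exp(-tA)` contracts `exp(𝔫⁺)` as `t → +∞`. -/
def unstableSpace (x : M) : Submodule ℝ (TangentSpace 𝓘(ℝ, V) x) :=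
  D.nPlus.map (fundamentalField x)

variable [Bundle.RiemannianBundle (fun x : M => TangentSpace 𝓘(ℝ, V) x)]

variable (V M) in
/-- `Σ_s = S*M ∩ E_u^*`, where `E_u^*(x)` is the annihilator of `E_u(x)` in `T_x^*M`. -/
def sigmaS : Set (cosphereBundle V M) :=
  {p | ∀ v ∈ unstableSpace D p.1.1, p.1.2 v = 0}

/-- The flow on the co-sphere bundle induced by `φ^A_t : x ↦ exp(tA) x`. -/
def cosphereFlow (A : D.𝔞) (t : ℝ) (p : CotangentBundle V M) : CotangentBundle V M :=
  cosphereLift (lieExp (t • (A : GroupLieAlgebra 𝓘(ℝ, E) G))) p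

/-- `U ⊆ S*M` is positively invariant under the flow induced by `φ^A`. -/
def IsPositivelyInvariant (A : D.𝔞) (U : Set (cosphereBundle V M)) : Prop :=
  ∀ t : ℝ, 0 ≤ t → Set.MapsTo (cosphereFlow D A t) (Subtype.val '' U) (Subtype.val '' U)

end

end Flag

end

/-!
The moment map `μ : T*F → 𝔤*`, `μ(x, ξ)(Y) = ξ(Y x)`, turns the flows on `T*F` into the coadjoint
action (`momentMap_cotangentLift`). Take a basis of root vectors `b j ∈ 𝔤_{α j}`, where `α j` is a
root or `0`. The lifted action of `exp (t A)` multiplies the component `μ(b j)` by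
`exp (-t α_j(A))`. For `A` in the positive chamber and `t ≥ 0`, the components with `α j ∈ Δ⁺` do not
grow and all the others do not shrink (`rootEnergy_cotangentLift_lieExp`). With `N₊` and `N₋` the
sums of squares of the two kinds of components, every conic set `{N₊ < δ N₋}` is therefore positively
invariant, and this for all `A` at the same time. The set `Σ_s` is the zero set of `N₊` on `S*F`, and
`N₋ > 0` there because `G` acts transitively, so that these sets contain `Σ_s`. Since `S*F` is
compact, `N₊` is bounded below on the complement of `V₀`, and `{N₊ < δ N₋} ⊆ V₀` for small `δ`.

Most of the work goes into the compactness of `F = G / P_C` (`compactSpace_flagManifold`), for which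
the global structure of `G` is only used through `Ad`.
* Automorphisms of `𝔤` near the identity are exponentials of derivations, derivations are inner, and
  `exp (ad X)` with small `X` is `Ad g` with `g` near `1` (`eventually_exists_groupAd_eq`).
* Let `K` be the group of all `g` for which `Ad g` commutes with the Cartan involution. As
  `𝔨 + 𝔭_C = 𝔤`, the set `Ad (K P_C)` contains all automorphisms near the identity
  (`eventually_exists_groupAd_mul_eq`). As `Ad K` preserves an inner product it is bounded, and it
  follows that left multiplication by automorphisms close to the identity preserves `Ad (K P_C)`.
  Hence `exp (ad X) ∈ Ad (K P_C)` for every `X`.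
* By the polar decomposition of automorphisms (`IwasawaData.exists_polar`) every `g` is `k h` with
  `k ∈ K` and `Ad h = exp (ad X)`. This yields `G = K P_C` (`exists_inv_mul_mem_adNormalizer`), and
  compactness follows since `Ad K` is totally bounded and `ker Ad ⊆ P_C`.

The compactness of `S*F` follows from that of `F` and the continuity of the dual norm
(`isCompact_cosphereBundle`). The differentiable structure of `F` enters through local sections of
the submersion `G → F`.
-/

noncomputable section

/-! ### Symmetric operators for a positive definite form -/

section SymmetricOperators

open Module.End in
theorem iSup_iInf_eigenspace_eq_top_of_posDef {V : Type*} [AddCommGroup V] [Module ℝ V]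
    [FiniteDimensional ℝ V] (B : LinearMap.BilinForm ℝ V) (hsymm : ∀ x y, B x y = B y x)
    (hpos : ∀ x, x ≠ 0 → 0 < B x x) {ι : Type*} (T : ι → Module.End ℝ V)
    (hT : ∀ i x y, B (T i x) y = B x (T i y)) (hc : ∀ i j, Commute (T i) (T j)) :
    ⨆ χ : ι → ℝ, ⨅ i, eigenspace (T i) (χ i) = ⊤ := by
  let c : InnerProductSpace.Core ℝ V :=
    { inner := fun x y => B x y
      conj_inner_symm := fun x y => by simpa using hsymm y x
      re_inner_nonneg := fun x => by
        rcases eq_or_ne x 0 with rfl | hx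
        · simp
        · simpa using (hpos x hx).le
      add_left := fun x y z => by simp
      smul_left := fun x y r => by simp
      definite := fun x h => by
        by_contra hx
        exact (hpos x hx).ne' h }
  let _ : NormedAddCommGroup V := c.toNormedAddCommGroup
  let _ : InnerProductSpace ℝ V := InnerProductSpace.ofCore c.toCore
  exact LinearMap.IsSymmetric.iSup_iInf_eq_top_of_commute (T := T) (fun i x y => hT i x y)
    (fun i j _ => hc i j)

/-- A basis can be extracted from any family of subspaces that spans. -/
theorem exists_basis_of_iSup_eq_top {V : Type*} [AddCommGroup V] [Module ℝ V]
    [FiniteDimensional ℝ V] {ι : Type*} (p : ι → Submodule ℝ V) (hp : ⨆ i, p i = ⊤) :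
    ∃ (n : ℕ) (b : Module.Basis (Fin n) ℝ V), ∀ j, ∃ i, b j ∈ p i := by
  have hs : (⊤ : Submodule ℝ V) ≤ Submodule.span ℝ (⋃ i, (p i : Set V)) := by
    rw [← hp]
    refine iSup_le fun i x hx => Submodule.subset_span (Set.mem_iUnion.2 ⟨i, hx⟩)
  let b := Module.Basis.ofSpan hs
  have : Fintype ((linearIndepOn_empty ℝ id).extend (Set.empty_subset (⋃ i, (p i : Set V)))) :=
    FiniteDimensional.fintypeBasisIndex b
  refine ⟨_, b.reindex (Fintype.equivFin _), fun j => ?_⟩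
  have := Module.Basis.ofSpan_subset hs (Set.mem_range_self ((Fintype.equivFin _).symm j))
  rw [Module.Basis.reindex_apply]
  exact Set.mem_iUnion.1 this

end SymmetricOperators

/-! ### Restricted root decomposition, parabolic subalgebras, polar decomposition -/

namespace IwasawaData

variable {L : Type*} [LieRing L] [LieAlgebra ℝ L] (D : IwasawaData L)

/-- The form `B_θ(X, Y) = -κ(X, θ Y)`, an inner product on `L`. -/
def form : LinearMap.BilinForm ℝ L :=
  -((killingForm ℝ L).compl₂ (D.θ : L →ₗ[ℝ] L))

theorem form_apply (X Y : L) : D.form X Y = -(killingForm ℝ L X (D.θ Y)) := rfl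

theorem form_pos {X : L} (hX : X ≠ 0) : 0 < D.form X X := D.θ_pos X hX

theorem form_comm (X Y : L) : D.form X Y = D.form Y X := by
  rw [form_apply, form_apply, ← LieAlgebra.killingForm_of_equiv_apply D.θ X, D.θ_involutive,
    LieModule.traceForm_comm]

theorem eq_zero_of_lie_eq_zero {L : Type*} [LieRing L] [LieAlgebra ℝ L] (D : IwasawaData L)
    {X : L} (h : ∀ Y : L, ⁅X, Y⁆ = 0) : X = 0 := by
  by_contra hX
  have h0 : LieAlgebra.ad ℝ L X = 0 := by ext Y; simpa using h Y
  have := D.θ_pos X hX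
  rw [killingForm_apply_apply, h0] at this
  simp at this

theorem isKilling {L : Type*} [LieRing L] [LieAlgebra ℝ L] (D : IwasawaData L) :
    LieAlgebra.IsKilling ℝ L := by
  constructor
  rw [LieSubmodule.eq_bot_iff]
  intro X hX
  by_contra h0
  rw [LieIdeal.mem_killingCompl] at hX
  have h := hX (D.θ X) trivial
  have := D.θ_pos X h0
  rw [LieModule.traceForm_comm] at h
  rw [h] at this
  simp at this

/-- The adjoint of `ad X` for `B_θ` is `-ad (θ X)`. -/
theorem form_lie (X Y Z : L) : D.form ⁅X, Y⁆ Z = -D.form Y ⁅D.θ X, Z⁆ := by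
  rw [form_apply, form_apply, LieModule.traceForm_apply_lie_apply', LieEquiv.map_lie,
    D.θ_involutive]

theorem θ_of_mem_𝔞 {H : L} (hH : H ∈ D.𝔞) : D.θ H = -H := D.𝔞_maximal.prop.1 H hH

theorem θ_mem_rootSpace {α : Module.Dual ℝ D.𝔞} {X : L} (hX : X ∈ D.rootSpace α) :
    D.θ X ∈ D.rootSpace (-α) := by
  intro H
  have h := congrArg D.θ (hX H)
  rw [LieEquiv.map_lie, D.θ_of_mem_𝔞 H.2, neg_lie, map_smul] at h
  rw [LinearMap.neg_apply, neg_smul, ← h, neg_neg]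

theorem neg_mem_roots {α : Module.Dual ℝ D.𝔞} (hα : α ∈ D.roots) : -α ∈ D.roots := by
  refine ⟨neg_ne_zero.2 hα.1, ?_⟩
  obtain ⟨X, hX, hX0⟩ := Submodule.exists_mem_ne_zero_of_ne_bot hα.2
  exact (Submodule.ne_bot_iff _).2 ⟨D.θ X, D.θ_mem_rootSpace hX, by simpa using hX0⟩

theorem mem_roots_iff {α : Module.Dual ℝ D.𝔞} : α ∈ D.roots ↔
    α ≠ 0 ∧ ∃ X : L, X ≠ 0 ∧ ∀ H : D.𝔞, ⁅(H : L), X⁆ = α H • X := by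
  constructor
  · rintro ⟨h0, h⟩
    obtain ⟨X, hX, hX0⟩ := Submodule.exists_mem_ne_zero_of_ne_bot h
    exact ⟨h0, X, hX0, hX⟩
  · rintro ⟨h0, X, hX0, hX⟩
    exact ⟨h0, (Submodule.ne_bot_iff _).2 ⟨X, hX, hX0⟩⟩

/-- A root that is not positive takes nonpositive values on the positive Weyl chamber. -/
theorem apply_nonpos_of_notMem_posRoots {α : Module.Dual ℝ D.𝔞} (hα : D.rootSpace α ≠ ⊥)
    (hpos : α ∉ D.posRoots) {A : D.𝔞} (hA : A ∈ D.weylChamber) : α A ≤ 0 := by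
  rcases eq_or_ne α 0 with rfl | h0
  · simp
  obtain ⟨H₀, hreg, heq⟩ := D.posRoots_eq
  have hroot : α ∈ D.roots := ⟨h0, hα⟩
  have hneg : -α ∈ D.posRoots := by
    rw [heq]
    refine ⟨D.mem_roots_iff.1 (D.neg_mem_roots hroot), ?_⟩
    have h1 : ¬ 0 < α H₀ := fun h => hpos (by rw [heq]; exact ⟨D.mem_roots_iff.1 hroot, h⟩)
    have h2 := hreg α (D.mem_roots_iff.1 hroot)
    have h3 : α H₀ < 0 := lt_of_le_of_ne (not_lt.1 h1) h2
    simpa using h3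
  have := hA _ hneg
  simpa using this

/-- The restricted root space decomposition, as a basis of joint eigenvectors of `ad 𝔞`. The
functionals `α j` are `0` or restricted roots. -/
theorem exists_rootBasis [FiniteDimensional ℝ L] :
    ∃ (n : ℕ) (b : Module.Basis (Fin n) ℝ L) (α : Fin n → Module.Dual ℝ D.𝔞),
      ∀ j, b j ∈ D.rootSpace (α j) := by
  have htop := iSup_iInf_eigenspace_eq_top_of_posDef D.form D.form_comm (fun x hx => D.form_pos hx)
    (fun H : D.𝔞 => LieAlgebra.ad ℝ L (H : L))
    (fun H x y => by
      rw [LieAlgebra.ad_apply, LieAlgebra.ad_apply, D.form_lie, D.θ_of_mem_𝔞 H.2, neg_lie,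
        map_neg, neg_neg])
    (fun H K => by
      have h := D.𝔞_maximal.prop.2 H H.2 K K.2
      refine LinearMap.ext fun x => ?_
      have := lie_lie (H : L) (K : L) x
      rw [h, zero_lie] at this
      exact (sub_eq_zero.1 this.symm))
  obtain ⟨n, b, hb⟩ := exists_basis_of_iSup_eq_top _ htop
  choose χ hχ using hb
  have hχ' : ∀ j (H : D.𝔞), ⁅(H : L), b j⁆ = χ j H • b j := fun j H => by
    have := (Submodule.mem_iInf _).1 (hχ j) H
    rwa [Module.End.mem_eigenspace_iff, LieAlgebra.ad_apply] at this
  refine ⟨n, b, fun j =>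
    { toFun := χ j
      map_add' := fun H K => ?_
      map_smul' := fun c H => ?_ }, fun j H => hχ' j H⟩
  · apply smul_left_injective ℝ (b.ne_zero j)
    change χ j (H + K) • b j = (χ j H + χ j K) • b j
    rw [add_smul, ← hχ', ← hχ', ← hχ', Submodule.coe_add, add_lie]
  · apply smul_left_injective ℝ (b.ne_zero j)
    change χ j (c • H) • b j = (c * χ j H) • b j
    rw [mul_smul, ← hχ', ← hχ', Submodule.coe_smul, smul_lie]

/-- `𝔤₀ = 𝔪 + 𝔞`, by the maximality of `𝔞`. -/
theorem mem_𝔪_sup_𝔞 {X : L} (hX : X ∈ D.rootSpace 0) : X ∈ D.𝔪 ⊔ D.𝔞 := by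
  have hX' : ∀ H : D.𝔞, ⁅(H : L), X⁆ = 0 := fun H => by simpa using hX H
  have hθ : ∀ H : D.𝔞, ⁅(H : L), D.θ X⁆ = 0 := fun H => by
    simpa using D.θ_mem_rootSpace hX H
  set Y : L := (1 / 2 : ℝ) • (X - D.θ X) with hY
  have hθY : D.θ Y = -Y := by
    rw [hY, map_smul, map_sub, D.θ_involutive, ← smul_neg, neg_sub]
  have hHY : ∀ H ∈ D.𝔞, ⁅H, Y⁆ = 0 := fun H hH => by
    rw [hY, lie_smul, lie_sub, hX' ⟨H, hH⟩, hθ ⟨H, hH⟩, sub_zero, smul_zero]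
  have hYH : ∀ H ∈ D.𝔞, ⁅Y, H⁆ = 0 := fun H hH => by
    rw [← lie_skew, hHY H hH, neg_zero]
  have hYa : Y ∈ D.𝔞 := by
    have hle := D.𝔞_maximal.le_of_ge (y := D.𝔞 ⊔ Submodule.span ℝ {Y}) ⟨?_, ?_⟩ le_sup_left
    · exact hle (Submodule.mem_sup_right (Submodule.mem_span_singleton_self Y))
    · intro Z hZ
      obtain ⟨H, hH, W, hW, rfl⟩ := Submodule.mem_sup.1 hZ
      obtain ⟨c, rfl⟩ := Submodule.mem_span_singleton.1 hW
      rw [map_add, map_smul, hθY, D.θ_of_mem_𝔞 hH, smul_neg, neg_add]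
    · intro Z hZ Z' hZ'
      obtain ⟨H, hH, W, hW, rfl⟩ := Submodule.mem_sup.1 hZ
      obtain ⟨c, rfl⟩ := Submodule.mem_span_singleton.1 hW
      obtain ⟨H', hH', W', hW', rfl⟩ := Submodule.mem_sup.1 hZ'
      obtain ⟨c', rfl⟩ := Submodule.mem_span_singleton.1 hW'
      simp [D.𝔞_maximal.prop.2 H hH H' hH', hHY H hH, hYH H' hH']
  have hm : (1 / 2 : ℝ) • (X + D.θ X) ∈ D.𝔪 := by
    refine ⟨by rw [map_smul, map_add, D.θ_involutive, add_comm], fun H => ?_⟩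
    rw [lie_smul, lie_add, hX' H, hθ H, add_zero, smul_zero]
  have hsum : X = (1 / 2 : ℝ) • (X + D.θ X) + Y := by
    rw [hY]
    module
  rw [hsum]
  exact Submodule.add_mem_sup hm hYa

variable (C : Set D.𝔞)

theorem rootSpace_le_parabolic {α : Module.Dual ℝ D.𝔞}
    (hα : (∀ H ∈ C, α H = 0) ∨ ∀ H ∈ C, 0 < α H) : D.rootSpace α ≤ D.parabolic C := by
  rcases eq_or_ne α 0 with rfl | h0
  · exact fun X hX => Submodule.mem_sup_left (D.mem_𝔪_sup_𝔞 hX)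
  by_cases hb : D.rootSpace α = ⊥
  · rw [hb]
    exact bot_le
  · refine le_sup_of_le_right (le_iSup₂_of_le α ?_ le_rfl)
    exact hα.imp (fun h => ⟨⟨h0, hb⟩, h⟩) (fun h => ⟨⟨h0, hb⟩, h⟩)

theorem parabolic_eq_iSup : D.parabolic C =
    ⨆ α ∈ {α : Module.Dual ℝ D.𝔞 | (∀ H ∈ C, α H = 0) ∨ ∀ H ∈ C, 0 < α H}, D.rootSpace α := by
  apply le_antisymm
  · have h0 : D.rootSpace 0 ≤
        ⨆ α ∈ {α : Module.Dual ℝ D.𝔞 | (∀ H ∈ C, α H = 0) ∨ ∀ H ∈ C, 0 < α H}, D.rootSpace α :=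
      le_iSup₂_of_le 0 (Or.inl fun H _ => rfl) le_rfl
    refine sup_le (sup_le ?_ ?_) ?_
    · exact le_trans (show D.𝔪 ≤ D.rootSpace 0 from fun X hX H => by simpa using hX.2 H) h0
    · refine le_trans (show D.𝔞 ≤ D.rootSpace 0 from fun X hX H => ?_) h0
      simpa using D.𝔞_maximal.prop.2 H H.2 X hX
    · refine iSup₂_le fun α hα => le_iSup₂_of_le α ?_ le_rfl
      exact hα.imp (fun h => h.2) (fun h => h.2)
  · exact iSup₂_le fun α hα => D.rootSpace_le_parabolic C hα

theorem lie_mem_rootSpace_add {α β : Module.Dual ℝ D.𝔞} {X Y : L} (hX : X ∈ D.rootSpace α)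
    (hY : Y ∈ D.rootSpace β) : ⁅X, Y⁆ ∈ D.rootSpace (α + β) := by
  intro H
  rw [leibniz_lie, hX H, hY H, smul_lie, lie_smul, LinearMap.add_apply, add_smul]

/-- `𝔭_C` is a subalgebra. -/
theorem lie_mem_parabolic {X Y : L} (hX : X ∈ D.parabolic C) (hY : Y ∈ D.parabolic C) :
    ⁅X, Y⁆ ∈ D.parabolic C := by
  rw [parabolic_eq_iSup] at hX hY
  induction hX using Submodule.iSup_induction' with
  | zero => simp
  | add x y _ _ hx hy => rw [add_lie]; exact add_mem hx hy
  | mem α X hX =>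
    induction hX using Submodule.iSup_induction' with
    | zero => simp
    | add x y _ _ hx hy => rw [add_lie]; exact add_mem hx hy
    | mem hα X hX =>
      induction hY using Submodule.iSup_induction' with
      | zero => simp
      | add x y _ _ hx hy => rw [lie_add]; exact add_mem hx hy
      | mem β Y hY =>
        induction hY using Submodule.iSup_induction' with
        | zero => simp
        | add x y _ _ hx hy => rw [lie_add]; exact add_mem hx hy
        | mem hβ Y hY =>
          refine D.rootSpace_le_parabolic C ?_ (D.lie_mem_rootSpace_add hX hY)
          rcases hα with hα | hα <;> rcases hβ with hβ | hβ
          · exact Or.inl fun H hH => by simp [hα H hH, hβ H hH]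
          · exact Or.inr fun H hH => by simpa [hα H hH] using hβ H hH
          · exact Or.inr fun H hH => by simpa [hβ H hH] using hα H hH
          · exact Or.inr fun H hH => by simpa using add_pos (hα H hH) (hβ H hH)

/-- The fixed space `𝔨` of the Cartan involution. -/
def 𝔨 : Submodule ℝ L := LinearMap.eqLocus (D.θ : L →ₗ[ℝ] L) LinearMap.id

theorem mem_𝔨 {X : L} : X ∈ D.𝔨 ↔ D.θ X = X := Iff.rfl

/-- `𝔨 + 𝔭_C = 𝔤`: if `α` is negative on `C` then `X ∈ 𝔤_α` is the difference of `X + θ X ∈ 𝔨` and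
`θ X ∈ 𝔤_{-α} ⊆ 𝔭_C`. -/
theorem 𝔨_sup_parabolic [FiniteDimensional ℝ L]
    (hC : D.roots ⊆ D.rootsZero C ∪ D.rootsPos C ∪ D.rootsNeg C) :
    D.𝔨 ⊔ D.parabolic C = ⊤ := by
  obtain ⟨n, b, α, hb⟩ := D.exists_rootBasis
  rw [eq_top_iff, ← b.span_eq, Submodule.span_le]
  rintro _ ⟨j, rfl⟩
  rcases eq_or_ne (α j) 0 with h0 | h0
  · exact Submodule.mem_sup_right
      (D.rootSpace_le_parabolic C (Or.inl fun H _ => by simp [h0]) (hb j))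
  have hr : α j ∈ D.roots := ⟨h0, (Submodule.ne_bot_iff _).2 ⟨b j, hb j, b.ne_zero j⟩⟩
  rcases hC hr with (h | h) | h
  · exact Submodule.mem_sup_right (D.rootSpace_le_parabolic C (Or.inl h.2) (hb j))
  · exact Submodule.mem_sup_right (D.rootSpace_le_parabolic C (Or.inr h.2) (hb j))
  · have h1 : b j + D.θ (b j) ∈ D.𝔨 := by
      rw [mem_𝔨, map_add, D.θ_involutive, add_comm]
    have h2 : -D.θ (b j) ∈ D.parabolic C :=
      neg_mem (D.rootSpace_le_parabolic C (Or.inr fun H hH => by simpa using h.2 H hH)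
        (D.θ_mem_rootSpace (hb j)))
    have := Submodule.add_mem_sup h1 h2
    rwa [add_neg_cancel_right] at this

/-- The infinitesimal part of the polar decomposition of an automorphism `φ`: since
`B_θ(φ X, φ Y) = B_θ(X, θ φ⁻¹ θ φ Y)`, the automorphism `θ φ⁻¹ θ φ` is diagonalizable with positive
eigenvalues, and its logarithm is a derivation, so equal to `2 ad X` with `θ X = -X`. -/
theorem exists_polar [FiniteDimensional ℝ L] (φ : L ≃ₗ⁅ℝ⁆ L) :
    ∃ (X : L) (n : ℕ) (b : Module.Basis (Fin n) ℝ L) (c : Fin n → ℝ), D.θ X = -X ∧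
      (∀ j, ⁅X, b j⁆ = c j • b j) ∧
      ∀ j, D.θ (φ.symm (D.θ (φ (b j)))) = Real.exp (2 * c j) • b j := by
  let S : L ≃ₗ⁅ℝ⁆ L := (φ.trans D.θ).trans (φ.symm.trans D.θ)
  have hS : ∀ x, S x = D.θ (φ.symm (D.θ (φ x))) := fun x => rfl
  have hform : ∀ x y, D.form x (S y) = D.form (φ x) (φ y) := fun x y => by
    rw [hS, form_apply, form_apply, D.θ_involutive, ← LieAlgebra.killingForm_of_equiv_apply φ,
      LieEquiv.apply_symm_apply]
  have htop := iSup_iInf_eigenspace_eq_top_of_posDef D.form D.form_comm (fun x hx => D.form_pos hx)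
    (fun _ : Unit => (S : L →ₗ[ℝ] L))
    (fun _ x y => by
      change D.form (S x) y = D.form x (S y)
      rw [D.form_comm, hform, hform, D.form_comm])
    (fun _ _ => Commute.refl _)
  obtain ⟨n, b, hb⟩ := exists_basis_of_iSup_eq_top _ htop
  choose χ hχ using hb
  have hSb : ∀ j, S (b j) = χ j () • b j := fun j => by
    have := (Submodule.mem_iInf _).1 (hχ j) ()
    rwa [Module.End.mem_eigenspace_iff] at this
  have hpos : ∀ j, 0 < χ j () := fun j => by
    have h1 : 0 < D.form (φ (b j)) (φ (b j)) :=
      D.form_pos (by simpa using b.ne_zero j)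
    have h2 : 0 < D.form (b j) (b j) := D.form_pos (b.ne_zero j)
    rw [← hform, hSb, map_smul, smul_eq_mul] at h1
    exact pos_of_mul_pos_left h1 h2.le
  set l : Fin n → ℝ := fun j => Real.log (χ j ()) with hl
  let T : L →ₗ[ℝ] L := b.constr ℝ fun j => l j • b j
  have hT : ∀ j, T (b j) = l j • b j := fun j => by simp [T]
  -- `T` acts as `log μ` on the eigenspace of `S` for the eigenvalue `μ`
  have heig : ∀ (μ : ℝ) (x : L), S x = μ • x → T x = Real.log μ • x := by
    intro μ x hx
    have hx' : ∀ j, χ j () * b.repr x j = μ * b.repr x j := by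
      intro j
      have h1 : S x = ∑ i, (χ i () * b.repr x i) • b i := by
        conv_lhs => rw [← b.sum_repr x, map_sum]
        refine Finset.sum_congr rfl fun i _ => ?_
        rw [map_smul, hSb, smul_smul, mul_comm]
      have h2 := congrArg (fun z => b.repr z j) h1
      simp only [hx, map_smul, Finsupp.smul_apply, smul_eq_mul, b.repr_sum_self] at h2
      exact h2.symm
    conv_lhs => rw [← b.sum_repr x, map_sum]
    conv_rhs => rw [← b.sum_repr x, Finset.smul_sum]
    refine Finset.sum_congr rfl fun i _ => ?_
    rw [map_smul, hT, smul_comm]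
    rcases eq_or_ne (b.repr x i) 0 with h | h
    · simp [h]
    · rw [← mul_right_cancel₀ h (hx' i)]
  have hder : ∀ x y, T ⁅x, y⁆ = ⁅x, T y⁆ - ⁅y, T x⁆ := by
    have hbil : (LieModule.toEnd ℝ L L : L →ₗ[ℝ] _).compr₂ T =
        (LieModule.toEnd ℝ L L : L →ₗ[ℝ] _).compl₂ T -
        ((LieModule.toEnd ℝ L L : L →ₗ[ℝ] _).compl₂ T).flip := by
      refine b.ext fun i => b.ext fun j => ?_
      change T ⁅b i, b j⁆ = ⁅b i, T (b j)⁆ - ⁅b j, T (b i)⁆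
      have : S ⁅b i, b j⁆ = (χ i () * χ j ()) • ⁅b i, b j⁆ := by
        rw [LieEquiv.map_lie, hSb, hSb, smul_lie, lie_smul, smul_smul]
      rw [heig _ _ this, hT, hT, Real.log_mul (hpos i).ne' (hpos j).ne', lie_smul, lie_smul,
        ← lie_skew (b i) (b j)]
      module
    intro x y
    exact congrArg (fun f => f x y) hbil
  have := D.isKilling
  obtain ⟨Y, hY⟩ := LieDerivation.IsKilling.exists_eq_ad
    ({ T with leibniz' := fun x y => hder x y } : LieDerivation ℝ L L)
  have hY' : ∀ x, ⁅Y, x⁆ = T x := fun x => by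
    have := congrArg (fun d : LieDerivation ℝ L L => d x) hY
    simpa using this
  have hTsymm : ∀ x y, D.form (T x) y = D.form x (T y) := by
    have : D.form.comp T LinearMap.id = D.form.comp LinearMap.id T := by
      refine LinearMap.BilinForm.ext_basis b fun i j => ?_
      change D.form (T (b i)) (b j) = D.form (b i) (T (b j))
      rw [hT, hT, map_smul, map_smul, LinearMap.smul_apply, smul_eq_mul, smul_eq_mul]
      have h1 : χ i () * D.form (b i) (b j) = χ j () * D.form (b i) (b j) := by
        have h2 := hform (b i) (b j)
        have h3 := hform (b j) (b i)
        rw [hSb, map_smul, smul_eq_mul] at h2 h3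
        rw [h2, D.form_comm (b i), h3, D.form_comm]
      rcases eq_or_ne (D.form (b i) (b j)) 0 with h | h
      · simp [h]
      · rw [hl]
        simp only
        rw [mul_right_cancel₀ h h1]
    intro x y
    exact congrArg (fun f => f x y) this
  have hθY : D.θ Y = -Y := by
    have h0 : D.θ Y + Y = 0 := by
      refine D.eq_zero_of_lie_eq_zero fun z => ?_
      by_contra hz
      have h1 := D.form_pos hz
      have h2 := D.form_lie Y ⁅D.θ Y + Y, z⁆ z
      rw [hY', hTsymm, ← hY'] at h2
      have h3 : D.form ⁅D.θ Y + Y, z⁆ ⁅D.θ Y + Y, z⁆ = 0 := by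
        conv_lhs => arg 2; rw [add_lie]
        rw [map_add, h2]
        ring
      exact h1.ne' h3
    exact eq_neg_of_add_eq_zero_left h0
  refine ⟨(1 / 2 : ℝ) • Y, n, b, fun j => l j / 2, by rw [map_smul, hθY, smul_neg],
    fun j => ?_, fun j => ?_⟩
  · rw [smul_lie, hY', hT, smul_smul]
    congr 1
    ring
  · rw [← hS, hSb, mul_div_cancel₀ _ two_ne_zero, hl, Real.exp_log (hpos j)]

end IwasawaData

/-! ### Exponentials of derivations -/

section ExpDerivation

open NormedSpace Filter Topology

variable {W : Type*} [NormedAddCommGroup W] [NormedSpace ℝ W] [CompleteSpace W]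

theorem hasSum_exp_apply (T : W →L[ℝ] W) (x : W) :
    HasSum (fun n : ℕ => (n.factorial⁻¹ : ℝ) • (T ^ n) x) (exp T x) := by
  have h := NormedSpace.exp_series_hasSum_exp' (𝕂 := ℝ) T
  exact h.mapL (ContinuousLinearMap.apply ℝ W x)

theorem exp_apply_mem {T : W →L[ℝ] W} {p : Submodule ℝ W} (hp : IsClosed (p : Set W))
    (hT : ∀ x ∈ p, T x ∈ p) {x : W} (hx : x ∈ p) : exp T x ∈ p := by
  refine hp.mem_of_tendsto (hasSum_exp_apply T x) (Eventually.of_forall fun s => ?_)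
  have hn : ∀ n : ℕ, (T ^ n) x ∈ p := fun n => by
    induction n with
    | zero => simpa using hx
    | succ n ih => rw [pow_succ']; exact hT _ ih
  exact Submodule.sum_mem _ fun n _ => Submodule.smul_mem _ _ (hn n)

theorem exp_neg_mul_exp (T : W →L[ℝ] W) : exp (-T) * exp T = 1 := by
  let _ : NormedAlgebra ℚ (W →L[ℝ] W) := NormedAlgebra.restrictScalars ℚ ℝ _
  rw [← exp_add_of_commute (by simp), neg_add_cancel, exp_zero]

theorem exp_neg_apply_exp_apply (T : W →L[ℝ] W) (z : W) : exp (-T) (exp T z) = z :=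
  congrArg (fun S : W →L[ℝ] W => S z) (exp_neg_mul_exp T)

theorem exp_apply_of_apply_eq_smul {T : W →L[ℝ] W} {x : W} {c : ℝ} (h : T x = c • x) :
    exp T x = Real.exp c • x := by
  have hn : ∀ n : ℕ, (T ^ n) x = c ^ n • x := by
    intro n
    induction n with
    | zero => simp
    | succ n ih =>
      rw [pow_succ', mul_apply_eq_comp, ih, map_smul, h, smul_smul, pow_succ]
  have h1 := hasSum_exp_apply T x
  have h2 := (NormedSpace.exp_series_hasSum_exp' (𝕂 := ℝ) c).smul_const x
  rw [← Real.exp_eq_exp_ℝ] at h2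
  refine h1.unique (h2.congr_fun ?_)
  intro n
  rw [hn, smul_smul, smul_eq_mul]

theorem tendsto_exp_inv_smul (T : W →L[ℝ] W) :
    Tendsto (fun n : ℕ => exp ((n : ℝ)⁻¹ • T)) atTop (𝓝 1) := by
  have h1 : ContinuousAt (exp : (W →L[ℝ] W) → W →L[ℝ] W) 0 :=
    (hasStrictFDerivAt_exp_zero (𝕂 := ℝ) (𝔸 := W →L[ℝ] W)).continuousAt
  have h2 : Tendsto (fun n : ℕ => (n : ℝ)⁻¹ • T) atTop (𝓝 0) := by
    simpa using (tendsto_inv_atTop_nhds_zero_nat (𝕜 := ℝ)).smul_const T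
  have h3 := h1.tendsto.comp h2
  rwa [exp_zero] at h3

theorem exp_inv_smul_pow (T : W →L[ℝ] W) {n : ℕ} (hn : 0 < n) :
    exp ((n : ℝ)⁻¹ • T) ^ n = exp T := by
  let _ : NormedAlgebra ℚ (W →L[ℝ] W) := NormedAlgebra.restrictScalars ℚ ℝ _
  rw [← exp_nsmul, ← Nat.cast_smul_eq_nsmul ℝ, smul_smul,
    mul_inv_cancel₀ (by exact_mod_cast hn.ne'), one_smul]

/-- The derivative at `0` of `X ↦ exp (S X) exp (T X)`. -/
theorem hasStrictFDerivAt_exp_mul_exp {E 𝔸 : Type*} [NormedAddCommGroup E] [NormedSpace ℝ E]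
    [NormedRing 𝔸] [NormedAlgebra ℝ 𝔸] [CompleteSpace 𝔸] (S T : E →L[ℝ] 𝔸) :
    HasStrictFDerivAt (fun X => exp (S X) * exp (T X)) (S + T) 0 := by
  have h : ∀ c : E →L[ℝ] 𝔸, HasStrictFDerivAt (fun X => exp (c X)) c 0 := fun c => by
    have h0 : HasStrictFDerivAt (exp : 𝔸 → 𝔸) (1 : 𝔸 →L[ℝ] 𝔸) (c 0) := by
      rw [map_zero]
      exact hasStrictFDerivAt_exp_zero (𝕂 := ℝ)
    exact h0.comp (0 : E) c.hasStrictFDerivAt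
  refine ((h S).mul' (h T)).congr_fderiv (ContinuousLinearMap.ext fun X => ?_)
  simp [add_comm]

/-- The failure of `T` to be a derivation of the bilinear map `br`. -/
def derivDefect {W : Type*} [NormedAddCommGroup W] [NormedSpace ℝ W]
    (br : W →L[ℝ] W →L[ℝ] W) (T : W →L[ℝ] W) : W →L[ℝ] W →L[ℝ] W :=
  (ContinuousLinearMap.compL ℝ W W W T).comp br - br.comp T -
    ((ContinuousLinearMap.compL ℝ W W W).flip T).comp br

theorem derivDefect_apply {W : Type*} [NormedAddCommGroup W] [NormedSpace ℝ W]
    (br : W →L[ℝ] W →L[ℝ] W) (T : W →L[ℝ] W) (x y : W) :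
    derivDefect br T x y = T (br x y) - br (T x) y - br x (T y) := rfl

/-- The velocity of the conjugates of `br` by the one-parameter group `e^{tT}`. -/
theorem hasDerivAt_exp_conj (br : W →L[ℝ] W →L[ℝ] W) (T : W →L[ℝ] W) (x y : W) (t : ℝ) :
    HasDerivAt (fun t : ℝ => exp (t • T) (br (exp (-t • T) x) (exp (-t • T) y)))
      (exp (t • T) (derivDefect br T (exp (-t • T) x) (exp (-t • T) y))) t := by
  have h1 : HasDerivAt (fun t : ℝ => exp (t • T)) (exp (t • T) * T) t :=
    hasDerivAt_exp_smul_const T t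
  have h2 : HasDerivAt (fun t : ℝ => exp (-t • T)) (-(T * exp (-t • T))) t := by
    have := (hasDerivAt_exp_smul_const' T (-t)).scomp t (hasDerivAt_neg t)
    simpa [Function.comp_def] using this
  have h3 : ∀ z, HasDerivAt (fun t : ℝ => exp (-t • T) z) (-(T (exp (-t • T) z))) t := fun z => by
    have := h2.clm_apply (hasDerivAt_const t z)
    simpa using this
  have h4 := (((br.hasFDerivAt.comp_hasDerivAt t (h3 x))).clm_apply (h3 y))
  refine (h1.clm_apply h4).congr_deriv ?_
  simp only [derivDefect_apply, map_sub, map_neg, mul_apply_eq_comp, map_add,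
    neg_apply, Function.comp_apply]
  abel

/-- The exponential of a derivation is an automorphism. -/
theorem exp_apply_bilin {br : W →L[ℝ] W →L[ℝ] W} {T : W →L[ℝ] W} (hT : derivDefect br T = 0)
    (x y : W) : exp T (br x y) = br (exp T x) (exp T y) := by
  have hconst := is_const_of_deriv_eq_zero
    (fun t => (hasDerivAt_exp_conj br T (exp T x) (exp T y) t).differentiableAt)
    (fun t => by rw [(hasDerivAt_exp_conj br T (exp T x) (exp T y) t).deriv, hT]; simp) 1 0
  simpa [exp_neg_apply_exp_apply] using hconst

/-- A small `T` whose exponential is an automorphism is a derivation: the curve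
`e^{tT} [e^{-tT} x, e^{-tT} y]` takes the same value at `0` and `1` while its velocity stays close
to the defect of `T`. -/
theorem eventually_derivDefect_eq_zero (br : W →L[ℝ] W →L[ℝ] W) :
    ∀ᶠ T : W →L[ℝ] W in 𝓝 0, (∀ x y, exp T (br x y) = br (exp T x) (exp T y)) →
      derivDefect br T = 0 := by
  have hcont : ContinuousAt (exp : (W →L[ℝ] W) → W →L[ℝ] W) 0 :=
    (hasStrictFDerivAt_exp_zero (𝕂 := ℝ) (𝔸 := W →L[ℝ] W)).continuousAt
  -- if `e^{tT}` is `1/10`-close to the identity, the velocity is `‖N‖ / 2`-close to the defect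
  -- `N`, as `1/10 * (11/10)^2 + 1/10 * 11/10 + 1/10 ≤ 1/2`; hence `‖N‖ ≤ ‖N‖ / 2`
  obtain ⟨r, hr, hball⟩ := Metric.continuousAt_iff.1 hcont (1 / 10) (by norm_num)
  filter_upwards [Metric.ball_mem_nhds (0 : W →L[ℝ] W) hr] with T hT haut
  have hsmall : ∀ t : ℝ, |t| ≤ 1 → ‖exp (t • T) - 1‖ ≤ 1 / 10 := by
    intro t ht
    have h1 : dist (t • T) 0 < r := by
      rw [mem_ball_zero_iff] at hT
      rw [dist_zero_right, norm_smul]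
      exact lt_of_le_of_lt (mul_le_of_le_one_left (norm_nonneg _) ht) hT
    have := hball h1
    rw [exp_zero, dist_eq_norm] at this
    exact this.le
  set N := derivDefect br T with hN
  have hbound : ∀ x y, ‖N x y‖ ≤ ‖N‖ / 2 * ‖x‖ * ‖y‖ := by
    intro x y
    have key := Convex.norm_image_sub_le_of_norm_hasDerivWithin_le
      (f := fun t : ℝ => exp (t • T) (br (exp (-t • T) x) (exp (-t • T) y)) - t • N x y)
      (f' := fun t : ℝ => exp (t • T) (N (exp (-t • T) x) (exp (-t • T) y)) - N x y)
      (C := ‖N‖ / 2 * ‖x‖ * ‖y‖) (s := Set.Icc 0 1) (x := 0) (y := 1)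
      (fun t _ => by
        have := (hasDerivAt_exp_conj br T x y t).sub ((hasDerivAt_id t).smul_const (N x y))
        rw [one_smul] at this
        exact this.hasDerivWithinAt)
      (fun t ht => by
        have ht1 : |t| ≤ 1 := abs_le.2 ⟨by linarith [ht.1], ht.2⟩
        have hu := hsmall t ht1
        have hv := hsmall (-t) (by rwa [abs_neg])
        set u := exp (t • T)
        set v := exp (-t • T)
        have hx : ‖(v - 1) x‖ ≤ 1 / 10 * ‖x‖ := (v - 1).le_of_opNorm_le hv x
        have hy : ‖(v - 1) y‖ ≤ 1 / 10 * ‖y‖ := (v - 1).le_of_opNorm_le hv y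
        have hvx : ‖v x‖ ≤ 11 / 10 * ‖x‖ := by
          have : v x = x + (v - 1) x := by simp
          rw [this]
          exact (norm_add_le _ _).trans (by linarith)
        have hvy : ‖v y‖ ≤ 11 / 10 * ‖y‖ := by
          have : v y = y + (v - 1) y := by simp
          rw [this]
          exact (norm_add_le _ _).trans (by linarith)
        have hsplit : u (N (v x) (v y)) - N x y =
            (u - 1) (N (v x) (v y)) + N ((v - 1) x) (v y) + N x ((v - 1) y) := by
          simp only [sub_apply, one_apply_eq_self, map_sub]
          abel
        rw [hsplit]
        have e1 : ‖(u - 1) (N (v x) (v y))‖ ≤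
            1 / 10 * (‖N‖ * (11 / 10 * ‖x‖) * (11 / 10 * ‖y‖)) :=
          ((u - 1).le_of_opNorm_le hu _).trans (by
            gcongr
            exact (N.le_opNorm₂ _ _).trans (by gcongr))
        have e2 : ‖N ((v - 1) x) (v y)‖ ≤ ‖N‖ * (1 / 10 * ‖x‖) * (11 / 10 * ‖y‖) :=
          (N.le_opNorm₂ _ _).trans (by gcongr)
        have e3 : ‖N x ((v - 1) y)‖ ≤ ‖N‖ * ‖x‖ * (1 / 10 * ‖y‖) :=
          (N.le_opNorm₂ _ _).trans (by gcongr)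
        refine (norm_add₃_le).trans ?_
        have : 0 ≤ ‖N‖ * ‖x‖ * ‖y‖ := by positivity
        linarith)
      (convex_Icc 0 1) (by simp) (by simp)
    have hone : exp T (br (exp (-T) x) (exp (-T) y)) = br x y := by
      have hinv : ∀ z, exp T (exp (-T) z) = z := fun z => by
        simpa using exp_neg_apply_exp_apply (-T) z
      rw [haut, hinv, hinv]
    simpa [hone] using key
  have h0 : 0 ≤ ‖N‖ := norm_nonneg N
  have hle := ContinuousLinearMap.opNorm_le_bound₂ N (by positivity) hbound
  have : ‖N‖ = 0 := le_antisymm (by linarith) h0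
  refine ContinuousLinearMap.ext fun x => ContinuousLinearMap.ext fun y => ?_
  have hxy := hbound x y
  rw [this] at hxy
  simpa using hxy

/-- A local logarithm of linear maps near the identity. -/
theorem exists_local_log : ∃ ℓ : (W →L[ℝ] W) → W →L[ℝ] W,
    HasStrictFDerivAt ℓ (ContinuousLinearMap.id ℝ (W →L[ℝ] W)) 1 ∧ ℓ 1 = 0 ∧
      ∀ᶠ φ in 𝓝 (1 : W →L[ℝ] W), exp (ℓ φ) = φ := by
  have h : HasStrictFDerivAt (exp : (W →L[ℝ] W) → W →L[ℝ] W)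
      ((ContinuousLinearEquiv.refl ℝ (W →L[ℝ] W) : (W →L[ℝ] W) ≃L[ℝ] (W →L[ℝ] W)) :
        (W →L[ℝ] W) →L[ℝ] (W →L[ℝ] W)) 0 :=
    hasStrictFDerivAt_exp_zero (𝕂 := ℝ) (𝔸 := W →L[ℝ] W)
  refine ⟨h.localInverse _ _ _, ?_, ?_, ?_⟩
  · have := h.to_localInverse
    rwa [exp_zero] at this
  · have := h.localInverse_apply_image
    rwa [exp_zero] at this
  · have := h.eventually_right_inverse
    rwa [exp_zero] at this

end ExpDerivation

/-! ### The adjoint representation of a Lie group -/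

section AdjointRepresentation

open Filter Topology VectorField

variable {E : Type*} [NormedAddCommGroup E] [NormedSpace ℝ E]
  {G : Type*} [TopologicalSpace G] [ChartedSpace E G] [Group G]

/-- `Ad g` as a continuous linear map of the model space `E = T₁G`. -/
def groupAd (g : G) : E →L[ℝ] E :=
  mfderiv 𝓘(ℝ, E) 𝓘(ℝ, E) (fun x : G => g * x * g⁻¹) 1

theorem groupAd_one : (groupAd (1 : G) : E →L[ℝ] E) = 1 :=
  ContinuousLinearMap.ext fun X => congrArg (fun f => f X) (lieAd_one (E := E) (G := G))

/-- The product of `G` read in the chart at `1`. -/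
def chartMul (E G : Type*) [NormedAddCommGroup E] [NormedSpace ℝ E] [TopologicalSpace G]
    [ChartedSpace E G] [Group G] (p : E × E) : E :=
  extChartAt 𝓘(ℝ, E) (1 : G)
    ((extChartAt 𝓘(ℝ, E) (1 : G)).symm p.1 * (extChartAt 𝓘(ℝ, E) (1 : G)).symm p.2)

/-- The inverse of the chart of `G` at `1`. -/
abbrev chartInv (E G : Type*) [NormedAddCommGroup E] [NormedSpace ℝ E] [TopologicalSpace G]
    [ChartedSpace E G] [Group G] : E → G := (extChartAt 𝓘(ℝ, E) (1 : G)).symm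

/-- The coordinates of `1`. -/
abbrev chartOne (E G : Type*) [NormedAddCommGroup E] [NormedSpace ℝ E] [TopologicalSpace G]
    [ChartedSpace E G] [Group G] : E := extChartAt 𝓘(ℝ, E) (1 : G) 1

theorem chartInv_chartOne : chartInv E G (chartOne E G) = 1 := extChartAt_to_inv _

theorem tendsto_mk_chartOne : Tendsto (fun x => (x, chartOne E G)) (𝓝 (chartOne E G))
    (𝓝 (chartOne E G, chartOne E G)) :=
  (Continuous.prodMk_left (chartOne E G)).tendsto _

theorem tendsto_chartOne_mk : Tendsto (fun x => (chartOne E G, x)) (𝓝 (chartOne E G))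
    (𝓝 (chartOne E G, chartOne E G)) :=
  (Continuous.prodMk_right (chartOne E G)).tendsto _

theorem contMDiffAt_chartInv : ContMDiffAt 𝓘(ℝ, E) 𝓘(ℝ, E) ∞ (chartInv E G) (chartOne E G) := by
  have := contMDiffWithinAt_extChartAt_symm_range_self (I := 𝓘(ℝ, E)) (n := ∞) (1 : G)
  rw [modelWithCornersSelf_coe, Set.range_id] at this
  exact this

theorem continuousAt_chartInv : ContinuousAt (chartInv E G) (chartOne E G) :=
  contMDiffAt_chartInv.continuousAt

variable [LieGroup 𝓘(ℝ, E) ∞ G]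

theorem groupAd_mul (g h : G) : (groupAd (g * h) : E →L[ℝ] E) = groupAd g * groupAd h :=
  ContinuousLinearMap.ext fun X => congrArg (fun f => f X) (lieAd_mul (E := E) g h)

theorem groupAd_mul_apply (g h : G) (X : E) :
    (groupAd (g * h) : E →L[ℝ] E) X = groupAd g (groupAd h X : E) := by
  rw [groupAd_mul]; rfl

theorem groupAd_inv_apply_self (g : G) (X : E) :
    (groupAd g⁻¹ : E →L[ℝ] E) (groupAd g X : E) = X := by
  rw [← groupAd_mul_apply, inv_mul_cancel, groupAd_one]; rfl

theorem groupAd_apply_inv_self (g : G) (X : E) :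
    (groupAd g : E →L[ℝ] E) (groupAd g⁻¹ X : E) = X := by
  rw [← groupAd_mul_apply, mul_inv_cancel, groupAd_one]; rfl

theorem contMDiff_groupAd : ContMDiff 𝓘(ℝ, E) 𝓘(ℝ, E →L[ℝ] E) ∞ (groupAd : G → E →L[ℝ] E) := by
  intro x₀
  have hf : ContMDiff (𝓘(ℝ, E).prod 𝓘(ℝ, E)) 𝓘(ℝ, E) ∞
      (Function.uncurry fun (g x : G) => g * x * g⁻¹) :=
    (contMDiff_fst.mul contMDiff_snd).mul contMDiff_fst.inv
  have h := ContMDiffAt.mfderiv (m := ∞) (n := ∞) (x₀ := x₀) (fun (g x : G) => g * x * g⁻¹)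
    (fun _ => (1 : G)) hf.contMDiffAt contMDiffAt_const le_rfl
  refine h.congr_of_eventuallyEq (Eventually.of_forall fun x => ?_)
  have h1 : ∀ y : G, y * 1 * y⁻¹ = 1 := fun y => by simp
  refine Eq.trans ?_ (inTangentCoordinates_eq (I := 𝓘(ℝ, E)) (I' := 𝓘(ℝ, E)) (fun _ : G => (1 : G))
    (fun y : G => y * 1 * y⁻¹) groupAd (mem_chart_source _ _) (by
      simp only [h1]; exact mem_chart_source _ _)).symm
  -- the base points are `1` only up to an equation, so that the coordinate changes do not vanish
  -- definitionally
  have key : ∀ (p q : G) (hp : p = 1) (hq : q = 1) (v : E),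
      (tangentBundleCore 𝓘(ℝ, E) G).coordChange (achart E p) (achart E q) p v = v := by
    rintro _ _ rfl rfl v
    exact (tangentBundleCore 𝓘(ℝ, E) G).coordChange_self _ _ (by exact mem_chart_source _ _) v
  refine ContinuousLinearMap.ext fun X => ?_
  change _ = (tangentBundleCore 𝓘(ℝ, E) G).coordChange _ _ _
    (groupAd x ((tangentBundleCore 𝓘(ℝ, E) G).coordChange _ _ _ X : E) : E)
  rw [key _ _ (h1 x) (h1 x₀), key _ _ rfl rfl]

theorem contDiffAt_groupAd_chartInv :
    ContDiffAt ℝ ∞ (fun x => (groupAd (chartInv E G x) : E →L[ℝ] E)) (chartOne E G) := by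
  rw [← contMDiffAt_iff_contDiffAt]
  exact ContMDiffAt.comp _ (contMDiff_groupAd _) contMDiffAt_chartInv

theorem contDiffAt_chartMul : ContDiffAt ℝ ∞ (chartMul E G) (chartOne E G, chartOne E G) := by
  rw [← contMDiffAt_iff_contDiffAt]
  have h1 : ContMDiffAt 𝓘(ℝ, E × E) 𝓘(ℝ, E) ∞ (fun p : E × E => chartInv E G p.1)
      (chartOne E G, chartOne E G) :=
    ContMDiffAt.comp (chartOne E G, chartOne E G) contMDiffAt_chartInv
      contDiff_fst.contMDiff.contMDiffAt
  have h2 : ContMDiffAt 𝓘(ℝ, E × E) 𝓘(ℝ, E) ∞ (fun p : E × E => chartInv E G p.2)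
      (chartOne E G, chartOne E G) :=
    ContMDiffAt.comp (chartOne E G, chartOne E G) contMDiffAt_chartInv
      contDiff_snd.contMDiff.contMDiffAt
  refine ContMDiffAt.comp (chartOne E G, chartOne E G) (I' := 𝓘(ℝ, E)) ?_ (h1.mul h2)
  have : chartInv E G (chartOne E G) * chartInv E G (chartOne E G) = 1 := by
    rw [chartInv_chartOne, one_mul]
  simp only [this]
  exact contMDiffAt_extChartAt

theorem hasMFDerivAt_chartInv :
    HasMFDerivAt 𝓘(ℝ, E) 𝓘(ℝ, E) (chartInv E G) (chartOne E G) (ContinuousLinearMap.id ℝ E) := by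
  have h := (contMDiffAt_chartInv (E := E) (G := G)).mdifferentiableAt (by simp)
  have h2 := h.hasMFDerivAt
  have h3 := mfderivWithin_range_extChartAt_symm (I := 𝓘(ℝ, E)) (x := (1 : G))
  rw [modelWithCornersSelf_coe, Set.range_id, mfderivWithin_univ] at h3
  rw [h3] at h2
  exact h2

theorem hasMFDerivAt_chart :
    HasMFDerivAt 𝓘(ℝ, E) 𝓘(ℝ, E) (extChartAt 𝓘(ℝ, E) (1 : G)) 1 (ContinuousLinearMap.id ℝ E) := by
  have h : MDifferentiableAt 𝓘(ℝ, E) 𝓘(ℝ, E) (extChartAt 𝓘(ℝ, E) (1 : G)) 1 :=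
    (contMDiffAt_extChartAt (n := ∞)).mdifferentiableAt (by simp)
  have h2 := h.hasMFDerivAt
  rw [mfderiv_extChartAt_self] at h2
  exact h2

/-- The derivative of the chart expression of conjugation by `g` is `Ad g`. -/
theorem hasFDerivAt_chart_conj (g : G) :
    HasFDerivAt (fun y => extChartAt 𝓘(ℝ, E) (1 : G) (g * chartInv E G y * g⁻¹))
      (groupAd g : E →L[ℝ] E) (chartOne E G) := by
  have h1 := hasMFDerivAt_chartInv (E := E) (G := G)
  have h2 : HasMFDerivAt 𝓘(ℝ, E) 𝓘(ℝ, E) (fun x : G => g * x * g⁻¹)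
      (chartInv E G (chartOne E G)) (groupAd g : E →L[ℝ] E) := by
    rw [chartInv_chartOne]
    exact ((contMDiff_conj g).mdifferentiableAt (by simp)).hasMFDerivAt
  have h3 : HasMFDerivAt 𝓘(ℝ, E) 𝓘(ℝ, E) (extChartAt 𝓘(ℝ, E) (1 : G))
      (g * chartInv E G (chartOne E G) * g⁻¹) (ContinuousLinearMap.id ℝ E) := by
    have : g * chartInv E G (chartOne E G) * g⁻¹ = 1 := by rw [chartInv_chartOne]; simp
    rw [this]
    exact hasMFDerivAt_chart
  have h4 := HasMFDerivAt.comp (f := chartInv E G) (g := fun x : G => g * x * g⁻¹) _ h2 h1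
  have h5 := HasMFDerivAt.comp (f := (fun x : G => g * x * g⁻¹) ∘ chartInv E G)
    (g := extChartAt 𝓘(ℝ, E) (1 : G)) (chartOne E G) h3 h4
  exact hasMFDerivAt_iff_hasFDerivAt.1 h5

theorem eventually_differentiableAt_chartMul :
    ∀ᶠ p in 𝓝 (chartOne E G, chartOne E G), DifferentiableAt ℝ (chartMul E G) p := by
  have h : ContDiffAt ℝ 1 (chartMul E G) (chartOne E G, chartOne E G) :=
    contDiffAt_chartMul.of_le (by exact_mod_cast le_top)
  filter_upwards [h.eventually (by simp)] with p hp
  exact hp.differentiableAt (by simp)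

/-- `D₂m(x, e) = D₁m(e, x) ∘ Ad x` in the chart at `1`, as `L_x = R_x ∘ conj_x`. -/
theorem eventually_fderiv_chartMul :
    ∀ᶠ x in 𝓝 (chartOne E G), ∀ w : E,
      fderiv ℝ (chartMul E G) (x, chartOne E G) (0, w) =
      fderiv ℝ (chartMul E G) (chartOne E G, x) ((groupAd (chartInv E G x) : E →L[ℝ] E) w, 0) := by
  filter_upwards [tendsto_mk_chartOne.eventually eventually_differentiableAt_chartMul,
    tendsto_chartOne_mk.eventually eventually_differentiableAt_chartMul] with x hx hx' w
  set g : G := chartInv E G x with hg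
  have h1 : HasFDerivAt (fun y => chartMul E G (x, y))
      ((fderiv ℝ (chartMul E G) (x, chartOne E G)).comp (ContinuousLinearMap.inr ℝ E E))
      (chartOne E G) :=
    hx.hasFDerivAt.comp (chartOne E G) (hasFDerivAt_prodMk_right x (chartOne E G))
  have hc := hasFDerivAt_chart_conj (E := E) g
  have hc1 : extChartAt 𝓘(ℝ, E) (1 : G) (g * chartInv E G (chartOne E G) * g⁻¹) = chartOne E G := by
    rw [chartInv_chartOne, mul_one, mul_inv_cancel]
  have h2 : HasFDerivAt (fun y => chartMul E G
        (extChartAt 𝓘(ℝ, E) (1 : G) (g * chartInv E G y * g⁻¹), x))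
      ((fderiv ℝ (chartMul E G) (chartOne E G, x)).comp
        ((ContinuousLinearMap.inl ℝ E E).comp (groupAd g))) (chartOne E G) := by
    have h3 := hx'.hasFDerivAt
    rw [← hc1] at h3
    have h4 := h3.comp (chartOne E G) ((hasFDerivAt_prodMk_left _ x).comp (chartOne E G) hc)
    rw [hc1] at h4
    exact h4
  have hev : (fun y => chartMul E G (x, y)) =ᶠ[𝓝 (chartOne E G)] fun y => chartMul E G
        (extChartAt 𝓘(ℝ, E) (1 : G) (g * chartInv E G y * g⁻¹), x) := by
    have hcont : ContinuousAt (fun y => g * chartInv E G y * g⁻¹) (chartOne E G) := by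
      have hconj : Continuous fun z : G => g * z * g⁻¹ := (contMDiff_conj (E := E) g).continuous
      exact hconj.continuousAt.comp continuousAt_chartInv
    have hmem : (extChartAt 𝓘(ℝ, E) (1 : G)).source ∈ 𝓝 (g * chartInv E G (chartOne E G) * g⁻¹) := by
      rw [chartInv_chartOne]
      simpa using extChartAt_source_mem_nhds (I := 𝓘(ℝ, E)) (1 : G)
    filter_upwards [hcont.eventually hmem] with y hy
    unfold chartMul
    simp only
    rw [(extChartAt 𝓘(ℝ, E) (1 : G)).left_inv hy]
    rw [hg, inv_mul_cancel_right]
  have := congrArg (fun f : E →L[ℝ] E => f w) (h1.unique (h2.congr_of_eventuallyEq hev))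
  simpa using this

/-- The left-invariant vector field with value `w` at `1`, read in the chart at `1`. -/
theorem eventually_mpullbackWithin_mulInvariantVectorField (w : GroupLieAlgebra 𝓘(ℝ, E) G) :
    ∀ᶠ x in 𝓝 (chartOne E G), mpullbackWithin 𝓘(ℝ, E) 𝓘(ℝ, E) (chartInv E G)
      (mulInvariantVectorField w) (Set.range 𝓘(ℝ, E)) x =
      fderiv ℝ (chartMul E G) (x, chartOne E G) (0, (w : E)) := by
  filter_upwards [tendsto_mk_chartOne.eventually eventually_differentiableAt_chartMul,
    extChartAt_target_mem_nhds (I := 𝓘(ℝ, E)) (1 : G),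
    eventually_mem_nhds_iff.2 (extChartAt_target_mem_nhds (I := 𝓘(ℝ, E)) (1 : G))] with x hx hxt hxn
  set g : G := chartInv E G x with hg
  have hgs : g ∈ (extChartAt 𝓘(ℝ, E) (1 : G)).source := (extChartAt 𝓘(ℝ, E) (1 : G)).map_target hxt
  have e1 := mfderiv_extChartAt_comp_mfderivWithin_extChartAt_symm (I := 𝓘(ℝ, E)) hxt
  have e2 := mfderivWithin_extChartAt_symm_comp_mfderiv_extChartAt (I := 𝓘(ℝ, E)) hxt
  rw [mpullbackWithin_apply, ContinuousLinearMap.inverse_eq e2 e1]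
  have h1 : HasFDerivAt (fun y => chartMul E G (x, y))
      ((fderiv ℝ (chartMul E G) (x, chartOne E G)).comp (ContinuousLinearMap.inr ℝ E E))
      (chartOne E G) :=
    hx.hasFDerivAt.comp (chartOne E G) (hasFDerivAt_prodMk_right x (chartOne E G))
  have h2 : HasMFDerivAt 𝓘(ℝ, E) 𝓘(ℝ, E) (fun z : G => g * z)
      (chartInv E G (chartOne E G)) (mfderiv 𝓘(ℝ, E) 𝓘(ℝ, E) (fun z : G => g * z) 1 : E →L[ℝ] E) := by
    rw [chartInv_chartOne]
    exact ((contMDiff_mul_left (n := ∞)).mdifferentiableAt (by simp)).hasMFDerivAt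
  have h3 : HasMFDerivAt 𝓘(ℝ, E) 𝓘(ℝ, E) (extChartAt 𝓘(ℝ, E) (1 : G))
      (g * chartInv E G (chartOne E G))
      (mfderiv 𝓘(ℝ, E) 𝓘(ℝ, E) (extChartAt 𝓘(ℝ, E) (1 : G)) g : E →L[ℝ] E) := by
    have : g * chartInv E G (chartOne E G) = g := by rw [chartInv_chartOne, mul_one]
    rw [this]
    exact (mdifferentiableAt_extChartAt (by simpa using hgs)).hasMFDerivAt
  have h4 := HasMFDerivAt.comp (f := chartInv E G) (g := fun z : G => g * z) _ h2
    hasMFDerivAt_chartInv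
  have h5 := HasMFDerivAt.comp (f := (fun z : G => g * z) ∘ chartInv E G)
    (g := extChartAt 𝓘(ℝ, E) (1 : G)) (chartOne E G) h3 h4
  have h6 := hasMFDerivAt_iff_hasFDerivAt.1 h5
  have := congrArg (fun f : E →L[ℝ] E => f w) (h1.unique h6)
  exact this.symm

/-- The derivative of `Ad` at `1`, read in the chart at `1`, as a continuous bilinear map of the
model space. It is the Lie bracket by `groupBracket_apply`. -/
def groupBracket (E G : Type*) [NormedAddCommGroup E] [NormedSpace ℝ E] [TopologicalSpace G]
    [ChartedSpace E G] [Group G] : E →L[ℝ] E →L[ℝ] E :=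
  fderiv ℝ (fun x => (groupAd (chartInv E G x) : E →L[ℝ] E)) (chartOne E G)

/-- The derivative at `1` of the adjoint representation is `ad`: the second derivative of the product
in the chart computes the bracket of left-invariant fields as well as the derivative of `Ad`. -/
theorem groupBracket_apply (v w : GroupLieAlgebra 𝓘(ℝ, E) G) :
    groupBracket E G (v : E) (w : E) = (⁅v, w⁆ : GroupLieAlgebra 𝓘(ℝ, E) G) := by
  set e := chartOne E G
  set m := chartMul E G
  have hm1 : ContDiffAt ℝ 1 (fderiv ℝ m) (e, e) :=
    contDiffAt_chartMul.fderiv_right (m := 1) (by norm_cast)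
  have hD : HasFDerivAt (fderiv ℝ m) (fderiv ℝ (fderiv ℝ m) (e, e)) (e, e) :=
    (hm1.differentiableAt (by simp)).hasFDerivAt
  set B := fderiv ℝ (fderiv ℝ m) (e, e) with hB
  have hsymm : ∀ p q, B p q = B q p := by
    have := (contDiffAt_chartMul (E := E) (G := G)).isSymmSndFDerivAt (by
      rw [minSmoothness_of_isRCLikeNormedField]; exact ENat.LEInfty.out)
    intro p q
    exact this p q
  have hleft : ∀ w : E, HasFDerivAt (fun x => fderiv ℝ m (x, e) (0, w))
      ((ContinuousLinearMap.apply ℝ E ((0, w) : E × E)).comp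
        (B.comp (ContinuousLinearMap.inl ℝ E E))) e := fun w =>
    (ContinuousLinearMap.apply ℝ E ((0, w) : E × E)).hasFDerivAt.comp e
      (HasFDerivAt.comp (f := fun x => (x, e)) e hD (hasFDerivAt_prodMk_left e e))
  have hright : HasFDerivAt (fun x => fderiv ℝ m (e, x)) (B.comp (ContinuousLinearMap.inr ℝ E E)) e :=
    hD.comp e (hasFDerivAt_prodMk_right e e)
  have hAd : HasFDerivAt (fun x => (groupAd (chartInv E G x) : E →L[ℝ] E)) (groupBracket E G) e :=
    (contDiffAt_groupAd_chartInv.differentiableAt (by simp)).hasFDerivAt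
  -- the partial derivatives of the product at `(e, e)` are the identity
  have hone : (groupAd (chartInv E G e) : E →L[ℝ] E) = 1 := by
    rw [chartInv_chartOne, groupAd_one]
  have hme : DifferentiableAt ℝ m (e, e) :=
    contDiffAt_chartMul.differentiableAt (by simp)
  have hmleft : ∀ u : E, fderiv ℝ m (e, e) (u, 0) = u := by
    have h1 : HasFDerivAt (fun x => m (x, e)) (ContinuousLinearMap.id ℝ E) e := by
      refine (hasFDerivAt_id e).congr_of_eventuallyEq ?_
      filter_upwards [extChartAt_target_mem_nhds (I := 𝓘(ℝ, E)) (1 : G)] with x hx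
      change extChartAt 𝓘(ℝ, E) (1 : G) (chartInv E G x * chartInv E G e) = x
      rw [chartInv_chartOne, mul_one]
      exact (extChartAt 𝓘(ℝ, E) (1 : G)).right_inv hx
    have h2 := HasFDerivAt.comp (f := fun x => (x, e)) e hme.hasFDerivAt
      (hasFDerivAt_prodMk_left e e)
    intro u
    exact congrArg (fun f : E →L[ℝ] E => f u) (h2.unique h1)
  have hmright : ∀ u : E, fderiv ℝ m (e, e) (0, u) = u := by
    have h1 : HasFDerivAt (fun x => m (e, x)) (ContinuousLinearMap.id ℝ E) e := by
      refine (hasFDerivAt_id e).congr_of_eventuallyEq ?_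
      filter_upwards [extChartAt_target_mem_nhds (I := 𝓘(ℝ, E)) (1 : G)] with x hx
      change extChartAt 𝓘(ℝ, E) (1 : G) (chartInv E G e * chartInv E G x) = x
      rw [chartInv_chartOne, one_mul]
      exact (extChartAt 𝓘(ℝ, E) (1 : G)).right_inv hx
    have h2 := HasFDerivAt.comp (f := fun x => (e, x)) e hme.hasFDerivAt
      (hasFDerivAt_prodMk_right e e)
    intro u
    exact congrArg (fun f : E →L[ℝ] E => f u) (h2.unique h1)
  -- differentiate `D₂m(x, e) u = D₁m(e, x) (Ad x u)` at `x = e` in the direction `a`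
  have hprod : ∀ u a : E, B (a, 0) (0, u) = B (0, a) (u, 0) + groupBracket E G a u := by
    intro u a
    have h1 : HasFDerivAt (fun x => ((groupAd (chartInv E G x) : E →L[ℝ] E) u, (0 : E)))
        ((ContinuousLinearMap.inl ℝ E E).comp
          ((ContinuousLinearMap.apply ℝ E u).comp (groupBracket E G))) e :=
      (ContinuousLinearMap.inl ℝ E E).hasFDerivAt.comp e
        ((ContinuousLinearMap.apply ℝ E u).hasFDerivAt.comp e hAd)
    have h2 := hright.clm_apply h1
    have h3 := (hleft u).unique (h2.congr_of_eventuallyEq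
      (eventually_fderiv_chartMul.mono fun x hx => hx u))
    have h4 := congrArg (fun f : E →L[ℝ] E => f a) h3
    simp only [hone, ContinuousLinearMap.comp_apply, ContinuousLinearMap.inl_apply,
      ContinuousLinearMap.inr_apply, ContinuousLinearMap.apply_apply, add_apply,
      ContinuousLinearMap.flip_apply, one_apply_eq_self, hmleft] at h4
    rw [h4, add_comm]
  -- in the chart, the left-invariant field of `u` is `x ↦ D₂m(x, e) u`
  have hbr : (⁅v, w⁆ : GroupLieAlgebra 𝓘(ℝ, E) G) =
      (B ((v : E), 0) (0, (w : E)) - B ((w : E), 0) (0, (v : E)) : E) := by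
    let F : GroupLieAlgebra 𝓘(ℝ, E) G → E → E := fun u => mpullbackWithin 𝓘(ℝ, E) 𝓘(ℝ, E)
      (chartInv E G) (mulInvariantVectorField u) (Set.range 𝓘(ℝ, E))
    have hF : ∀ u : GroupLieAlgebra 𝓘(ℝ, E) G, F u =ᶠ[𝓝 e] fun x => fderiv ℝ m (x, e) (0, (u : E)) :=
      fun u => eventually_mpullbackWithin_mulInvariantVectorField u
    have hFe : ∀ u : GroupLieAlgebra 𝓘(ℝ, E) G, F u e = (u : E) := fun u =>
      (hF u).eq_of_nhds.trans (hmright u)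
    have hF' : ∀ (u : GroupLieAlgebra 𝓘(ℝ, E) G) (a : E),
        fderiv ℝ (F u) e a = B (a, 0) (0, (u : E)) := fun u a => by
      rw [(hF u).fderiv_eq, (hleft u).fderiv]
      rfl
    have h0 : (⁅v, w⁆ : GroupLieAlgebra 𝓘(ℝ, E) G) =
        (lieBracketWithin ℝ (F v) (F w) (Set.univ ∩ Set.range 𝓘(ℝ, E)) e : E) := by
      rw [GroupLieAlgebra.bracket_def, ← mlieBracketWithin_univ, mlieBracketWithin_apply,
        mfderiv_extChartAt_self]
      exact congrArg (fun T : E →L[ℝ] E =>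
        T (lieBracketWithin ℝ (F v) (F w) (Set.univ ∩ Set.range 𝓘(ℝ, E)) e))
        ContinuousLinearMap.inverse_id
    rw [h0, modelWithCornersSelf_coe, Set.range_id, Set.inter_univ, lieBracketWithin_univ,
      lieBracket_eq]
    simp only
    rw [hFe, hFe]
    exact congrArg₂ (fun a b : E => a - b) (hF' w v) (hF' v w)
  have := hprod (w : E) (v : E)
  refine Eq.trans ?_ hbr.symm
  have h5 := hsymm ((w : E), 0) (0, (v : E))
  rw [h5, this]
  abel

/-- `Ad g` is an automorphism of the Lie algebra: conjugation pulls left-invariant vector fields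
back to left-invariant vector fields. -/
theorem lieAd_lie [CompleteSpace E] (g : G) (X Y : GroupLieAlgebra 𝓘(ℝ, E) G) :
    lieAd g ⁅X, Y⁆ = ⁅lieAd g X, lieAd g Y⁆ := by
  have hc : ∀ k x : G, MDifferentiableAt 𝓘(ℝ, E) 𝓘(ℝ, E) (fun x : G => k * x * k⁻¹) x :=
    fun k x => (contMDiff_conj k).mdifferentiableAt (by simp)
  have hL : ∀ k x : G, MDifferentiableAt 𝓘(ℝ, E) 𝓘(ℝ, E) (fun x : G => k * x) x :=
    fun k x => (contMDiff_mul_left (n := ∞)).mdifferentiableAt (by simp)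
  -- `dc_x` maps `V_u(x)` to `V_{Ad(k) u}(c x)` for `c` the conjugation by `k`
  have hfield : ∀ (k x : G) (u : GroupLieAlgebra 𝓘(ℝ, E) G),
      (mfderiv 𝓘(ℝ, E) 𝓘(ℝ, E) (fun x : G => k * x * k⁻¹) x : E →L[ℝ] E)
        (mulInvariantVectorField u x : E) =
      (mulInvariantVectorField (lieAd k u : GroupLieAlgebra 𝓘(ℝ, E) G) (k * x * k⁻¹) : E) := by
    intro k x u
    have h1 : (fun x : G => k * x * k⁻¹) ∘ (fun y : G => x * y) =
        (fun y : G => (k * x * k⁻¹) * y) ∘ (fun x : G => k * x * k⁻¹) := by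
      funext y
      simp [mul_assoc]
    have h2 := mfderiv_comp (I := 𝓘(ℝ, E)) (I' := 𝓘(ℝ, E)) (I'' := 𝓘(ℝ, E)) (1 : G)
      (hc k (x * 1)) (hL x 1)
    have h3 := mfderiv_comp (I := 𝓘(ℝ, E)) (I' := 𝓘(ℝ, E)) (I'' := 𝓘(ℝ, E)) (1 : G)
      (hL (k * x * k⁻¹) (k * 1 * k⁻¹)) (hc k 1)
    rw [h1, h3] at h2
    have h4 := congrArg (fun f : E →L[ℝ] E => f u) h2
    have h5 : k * 1 * k⁻¹ = 1 := by simp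
    have h6 : x * 1 = x := mul_one x
    rw [h5, h6] at h4
    exact h4.symm
  have hinv : ∀ (x : G), (mfderiv 𝓘(ℝ, E) 𝓘(ℝ, E) (fun x : G => g * x * g⁻¹) x : E →L[ℝ] E).inverse =
      (mfderiv 𝓘(ℝ, E) 𝓘(ℝ, E) (fun x : G => g⁻¹ * x * g⁻¹⁻¹) (g * x * g⁻¹) : E →L[ℝ] E) := by
    intro x
    have hid : ∀ (k l x : G), (∀ y, l * (k * y * k⁻¹) * l⁻¹ = y) →
        (mfderiv 𝓘(ℝ, E) 𝓘(ℝ, E) (fun x : G => l * x * l⁻¹) (k * x * k⁻¹) : E →L[ℝ] E).comp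
        (mfderiv 𝓘(ℝ, E) 𝓘(ℝ, E) (fun x : G => k * x * k⁻¹) x : E →L[ℝ] E) =
        ContinuousLinearMap.id ℝ E := by
      intro k l x hkl
      have h2 := mfderiv_comp (I := 𝓘(ℝ, E)) (I' := 𝓘(ℝ, E)) (I'' := 𝓘(ℝ, E)) x
        (hc l (k * x * k⁻¹)) (hc k x)
      have h3 : (fun x : G => l * x * l⁻¹) ∘ (fun x : G => k * x * k⁻¹) = id := funext hkl
      rw [h3, mfderiv_id] at h2
      exact h2.symm
    refine ContinuousLinearMap.inverse_eq ?_ (hid g g⁻¹ x fun y => by simp [mul_assoc])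
    have h := hid g⁻¹ g (g * x * g⁻¹) fun y => by simp [mul_assoc]
    have h5 : g⁻¹ * (g * x * g⁻¹) * g⁻¹⁻¹ = x := by simp [mul_assoc]
    rw [h5] at h
    exact h
  have hpull : ∀ u : GroupLieAlgebra 𝓘(ℝ, E) G,
      mpullback 𝓘(ℝ, E) 𝓘(ℝ, E) (fun x : G => g * x * g⁻¹) (mulInvariantVectorField u) =
      mulInvariantVectorField (lieAd g⁻¹ u : GroupLieAlgebra 𝓘(ℝ, E) G) := by
    intro u
    funext x
    rw [mpullback_apply]
    refine (congrArg (fun T : E →L[ℝ] E => T (mulInvariantVectorField u (g * x * g⁻¹) : E))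
      (hinv x)).trans ?_
    refine (hfield g⁻¹ (g * x * g⁻¹) u).trans ?_
    have h5 : g⁻¹ * (g * x * g⁻¹) * g⁻¹⁻¹ = x := by simp [mul_assoc]
    rw [h5]
  have key : ∀ u v : GroupLieAlgebra 𝓘(ℝ, E) G, lieAd g⁻¹ ⁅u, v⁆ = ⁅lieAd g⁻¹ u, lieAd g⁻¹ v⁆ := by
    intro u v
    have h := mpullback_mlieBracket (n := minSmoothness ℝ 3) (I := 𝓘(ℝ, E)) (I' := 𝓘(ℝ, E))
      (f := fun x : G => g * x * g⁻¹) (x₀ := 1)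
      (V := mulInvariantVectorField u) (W := mulInvariantVectorField v)
      (mdifferentiableAt_mulInvariantVectorField _) (mdifferentiableAt_mulInvariantVectorField _)
      (((contMDiff_conj g).contMDiffAt).of_le (by
        rw [minSmoothness_of_isRCLikeNormedField]; exact ENat.LEInfty.out))
      (minSmoothness_monotone (by norm_cast))
    rw [hpull, hpull, ← mulInvariantVector_mlieBracket, hpull] at h
    have h1 : ∀ w : GroupLieAlgebra 𝓘(ℝ, E) G, mulInvariantVectorField w (1 : G) = w := by
      intro w
      have h2 : (fun x : G => 1 * x) = id := by funext x; simp
      unfold mulInvariantVectorField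
      rw [h2, mfderiv_id]
      rfl
    rw [h1] at h
    exact h
  have hg : ∀ u : GroupLieAlgebra 𝓘(ℝ, E) G, lieAd (E := E) g⁻¹ (lieAd (E := E) g u) = u :=
    fun u => groupAd_inv_apply_self (E := E) g u
  have hg' : ∀ u : GroupLieAlgebra 𝓘(ℝ, E) G, lieAd (E := E) g (lieAd (E := E) g⁻¹ u) = u :=
    fun u => groupAd_apply_inv_self (E := E) g u
  have h := key (lieAd g X) (lieAd g Y)
  rw [hg, hg] at h
  rw [← h, hg']

end AdjointRepresentation

/-! ### The image of the adjoint representation -/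

section AdjointImage

open Filter Topology NormedSpace

variable {E : Type*} [NormedAddCommGroup E] [NormedSpace ℝ E]
  [CompleteSpace E]
  {G : Type*} [TopologicalSpace G] [ChartedSpace E G] [Group G] [LieGroup 𝓘(ℝ, E) ∞ G]

theorem groupAd_bracket (g : G) (x y : E) :
    (groupAd g : E →L[ℝ] E) (groupBracket E G x y) =
      groupBracket E G (groupAd g x : E) (groupAd g y : E) := by
  have key : ∀ x y : GroupLieAlgebra 𝓘(ℝ, E) G, (groupAd g : E →L[ℝ] E)
      (groupBracket E G (x : E) (y : E)) = groupBracket E G (groupAd g x : E) (groupAd g y : E) :=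
    fun x y => by
      have h1 := groupBracket_apply x y
      have h2 := groupBracket_apply (lieAd g x) (lieAd g y)
      rw [h1]
      exact (lieAd_lie g x y).trans h2.symm
  exact key x y

/-- `Ad g` as an automorphism of the Lie algebra. -/
def lieAdEquiv (g : G) : GroupLieAlgebra 𝓘(ℝ, E) G ≃ₗ⁅ℝ⁆ GroupLieAlgebra 𝓘(ℝ, E) G :=
  { lieAd (E := E) g with
    map_lie' := fun {X Y} => lieAd_lie g X Y
    invFun := lieAd (E := E) g⁻¹
    left_inv := fun X => groupAd_inv_apply_self (E := E) g X
    right_inv := fun X => groupAd_apply_inv_self (E := E) g X }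

theorem derivDefect_groupBracket (X : E) :
    derivDefect (groupBracket E G) (groupBracket E G X) = 0 := by
  refine ContinuousLinearMap.ext fun y => ContinuousLinearMap.ext fun z => ?_
  have key : ∀ X y z : GroupLieAlgebra 𝓘(ℝ, E) G,
      groupBracket E G (X : E) (groupBracket E G (y : E) (z : E)) -
        groupBracket E G (groupBracket E G (X : E) (y : E)) (z : E) -
        groupBracket E G (y : E) (groupBracket E G (X : E) (z : E)) = 0 := fun X y z => by
    have h : ∀ a b : GroupLieAlgebra 𝓘(ℝ, E) G, groupBracket E G (a : E) (b : E) =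
      (⁅a, b⁆ : GroupLieAlgebra 𝓘(ℝ, E) G) := groupBracket_apply
    rw [h y z, h X y, h X z]
    have e1 := h X ⁅y, z⁆
    have e2 := h ⁅X, y⁆ z
    have e3 := h y ⁅X, z⁆
    rw [e1, e2, e3, leibniz_lie X y z]
    exact (sub_sub _ _ _).trans (sub_self _)
  exact key X y z

theorem groupBracket_injective (D : IwasawaData (GroupLieAlgebra 𝓘(ℝ, E) G)) :
    Function.Injective (groupBracket E G) := by
  rw [injective_iff_map_eq_zero]
  intro X hX
  refine D.eq_zero_of_lie_eq_zero (X := X) fun Y => ?_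
  have := groupBracket_apply (G := G) X Y
  rw [hX] at this
  exact this.symm

variable [FiniteDimensional ℝ E]

instance finiteDimensional_groupLieAlgebra : FiniteDimensional ℝ (GroupLieAlgebra 𝓘(ℝ, E) G) :=
  inferInstanceAs (FiniteDimensional ℝ E)

/-- Every derivation of the Lie algebra is inner. -/
theorem exists_groupBracket_eq (D : IwasawaData (GroupLieAlgebra 𝓘(ℝ, E) G))
    {T : E →L[ℝ] E} (hT : derivDefect (groupBracket E G) T = 0) :
    ∃ X, groupBracket E G X = T := by
  have _ := D.isKilling
  let T' : GroupLieAlgebra 𝓘(ℝ, E) G →ₗ[ℝ] GroupLieAlgebra 𝓘(ℝ, E) G := T.toLinearMap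
  have hT' : ∀ x y, T' ⁅x, y⁆ = ⁅x, T' y⁆ - ⁅y, T' x⁆ := by
    intro x y
    have h1 : T (groupBracket E G (x : E) (y : E)) - groupBracket E G (T x : E) (y : E) -
        groupBracket E G (x : E) (T y : E) = 0 :=
      congrArg (fun f : E →L[ℝ] E →L[ℝ] E => f x y) hT
    have h2 : groupBracket E G (x : E) (y : E) = _ := groupBracket_apply x y
    have h3 : groupBracket E G (T x : E) (y : E) = _ := groupBracket_apply (T' x) y
    have h4 : groupBracket E G (x : E) (T y : E) = _ := groupBracket_apply x (T' y)
    rw [h2, h3, h4] at h1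
    have h5 : T' ⁅x, y⁆ - ⁅T' x, y⁆ - ⁅x, T' y⁆ = 0 := h1
    rw [← lie_skew y (T' x), sub_neg_eq_add, add_comm, ← sub_eq_zero, ← h5]
    abel
  obtain ⟨X, hX⟩ := LieDerivation.IsKilling.exists_eq_ad
    ({ T' with leibniz' := hT' } :
      LieDerivation ℝ (GroupLieAlgebra 𝓘(ℝ, E) G) (GroupLieAlgebra 𝓘(ℝ, E) G))
  have h1 : ∀ y, ⁅X, y⁆ = T' y := fun y => by
    have := congrArg (fun d : LieDerivation ℝ (GroupLieAlgebra 𝓘(ℝ, E) G)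
      (GroupLieAlgebra 𝓘(ℝ, E) G) => d y) hX
    simpa using this
  exact ⟨X, ContinuousLinearMap.ext fun y => (groupBracket_apply X y).trans (h1 y)⟩

/-- A local inverse of `X ↦ exp (ad X)`: the logarithm of an automorphism near the identity is a
derivation, hence inner. -/
theorem exists_local_ad_log (D : IwasawaData (GroupLieAlgebra 𝓘(ℝ, E) G)) :
    ∃ (ℓ : (E →L[ℝ] E) → E) (ℓ' : (E →L[ℝ] E) →L[ℝ] E), HasStrictFDerivAt ℓ ℓ' 1 ∧
      (∀ X, ℓ' (groupBracket E G X) = X) ∧ ∀ᶠ φ : E →L[ℝ] E in 𝓝 1,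
        (∀ x y, φ (groupBracket E G x y) = groupBracket E G (φ x) (φ y)) →
          exp (groupBracket E G (ℓ φ)) = φ := by
  obtain ⟨ℓ, hℓ, hℓ1, hexp⟩ := exists_local_log (W := E)
  obtain ⟨r₀, hr₀⟩ := ((groupBracket E G).toLinearMap).exists_leftInverse_of_injective
    (LinearMap.ker_eq_bot.2 (groupBracket_injective D))
  let r : (E →L[ℝ] E) →L[ℝ] E := LinearMap.toContinuousLinearMap r₀
  have hr : ∀ X, r (groupBracket E G X) = X := fun X => congrArg (fun f => f X) hr₀
  refine ⟨fun φ => r (ℓ φ), r, ?_, hr, ?_⟩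
  · exact (r.hasStrictFDerivAt.comp (1 : E →L[ℝ] E) hℓ).congr_fderiv
      (ContinuousLinearMap.comp_id r)
  · have ht : Tendsto ℓ (𝓝 1) (𝓝 0) := by
      have := hℓ.continuousAt.tendsto
      rwa [hℓ1] at this
    filter_upwards [ht.eventually (eventually_derivDefect_eq_zero (groupBracket E G)), hexp]
      with φ h1 h2 h3
    rw [h2] at h1
    obtain ⟨X, hX⟩ := exists_groupBracket_eq D (h1 h3)
    rw [← hX, hr, hX, h2]

/-- A map `u` into the automorphism group with derivative `ad` at a point where `u = 1` covers a
neighbourhood of the identity in the automorphism group. -/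
theorem eventually_exists_eq_of_hasStrictFDerivAt (D : IwasawaData (GroupLieAlgebra 𝓘(ℝ, E) G))
    {u : E → E →L[ℝ] E} {x₀ : E} (hu : HasStrictFDerivAt u (groupBracket E G) x₀) (hu1 : u x₀ = 1)
    (haut : ∀ X x y, u X (groupBracket E G x y) = groupBracket E G (u X x) (u X y))
    {S : Set E} (hS : S ∈ 𝓝 x₀) :
    ∀ᶠ φ : E →L[ℝ] E in 𝓝 1, (∀ x y, φ (groupBracket E G x y) = groupBracket E G (φ x) (φ y)) →
      ∃ X ∈ S, u X = φ := by
  obtain ⟨ℓ, ℓ', hℓ, hℓ', hexp⟩ := exists_local_ad_log D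
  have hut : Tendsto u (𝓝 x₀) (𝓝 1) := by
    have := hu.continuousAt.tendsto
    rwa [hu1] at this
  have hh : HasStrictFDerivAt (fun X => ℓ (u X)) (ContinuousLinearMap.id ℝ E) x₀ := by
    rw [← hu1] at hℓ
    exact (hℓ.comp x₀ hu).congr_fderiv (ContinuousLinearMap.ext hℓ')
  have himage := hh.map_nhds_eq_of_surj (LinearMap.range_eq_top.2 Function.surjective_id)
  have hmem := image_mem_map (m := fun X => ℓ (u X)) (inter_mem hS (hut.eventually hexp))
  rw [himage, hu1] at hmem
  filter_upwards [hℓ.continuousAt.eventually hmem, hexp] with φ h1 h2 h3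
  obtain ⟨X, ⟨hXS, hX⟩, hX'⟩ := h1
  refine ⟨X, hXS, ?_⟩
  have h4 : ℓ (u X) = ℓ φ := hX'
  rw [← h2 h3, ← h4, hX (haut X)]

/-- Automorphisms of the Lie algebra near the identity are of the form `Ad g` with `g` near `1`. -/
theorem eventually_exists_groupAd_eq (D : IwasawaData (GroupLieAlgebra 𝓘(ℝ, E) G))
    {N : Set G} (hN : N ∈ 𝓝 (1 : G)) :
    ∀ᶠ φ : E →L[ℝ] E in 𝓝 1, (∀ x y, φ (groupBracket E G x y) = groupBracket E G (φ x) (φ y)) →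
      ∃ g ∈ N, groupAd g = φ := by
  have hct : Tendsto (chartInv E G) (𝓝 (chartOne E G)) (𝓝 1) := by
    have := (continuousAt_chartInv (E := E) (G := G)).tendsto
    rwa [chartInv_chartOne] at this
  have hAd : HasStrictFDerivAt (fun x => (groupAd (chartInv E G x) : E →L[ℝ] E))
      (groupBracket E G) (chartOne E G) :=
    contDiffAt_groupAd_chartInv.hasStrictFDerivAt (by simp)
  filter_upwards [eventually_exists_eq_of_hasStrictFDerivAt D hAd
    (by rw [chartInv_chartOne, groupAd_one]) (fun X => groupAd_bracket _) (hct hN)] with φ h1 h2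
  obtain ⟨X, hX, h3⟩ := h1 h2
  exact ⟨chartInv E G X, hX, h3⟩

theorem exists_groupAd_eq_exp (D : IwasawaData (GroupLieAlgebra 𝓘(ℝ, E) G)) (X : E) :
    ∃ g : G, groupAd g = exp (groupBracket E G X) := by
  obtain ⟨n, hn, hn0⟩ := (((tendsto_exp_inv_smul (groupBracket E G X)).eventually
    (eventually_exists_groupAd_eq D univ_mem)).and (eventually_gt_atTop 0)).exists
  obtain ⟨g, -, hg⟩ := hn (fun x y => exp_apply_bilin (by
    rw [← map_smul]
    exact derivDefect_groupBracket _) x y)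
  refine ⟨g ^ n, ?_⟩
  have hpow : ∀ m : ℕ, (groupAd (g ^ m) : E →L[ℝ] E) = groupAd g ^ m := by
    intro m
    induction m with
    | zero => rw [pow_zero, pow_zero, groupAd_one]
    | succ m ih => rw [pow_succ, pow_succ, groupAd_mul, ih]
  rw [hpow, hg, exp_inv_smul_pow _ hn0]

end AdjointImage

/-! ### The subgroups `K` and `P_C` -/

section FlagCompact

open Filter Topology NormedSpace

/-- The isometry group of a positive definite form on a finite-dimensional space is bounded. -/
theorem exists_norm_le_of_preserves_posDef {W : Type*} [NormedAddCommGroup W] [NormedSpace ℝ W]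
    [FiniteDimensional ℝ W] (B : LinearMap.BilinForm ℝ W) (hB : ∀ x, x ≠ 0 → 0 < B x x) :
    ∃ c : ℝ, 0 < c ∧ ∀ φ : W →L[ℝ] W, (∀ x, B (φ x) (φ x) = B x x) → ‖φ‖ ≤ c := by
  have hcont : Continuous fun x => B x x := by
    let B' : W →L[ℝ] W →L[ℝ] ℝ := LinearMap.toContinuousLinearMap
      ((LinearMap.toContinuousLinearMap : (W →ₗ[ℝ] ℝ) ≃ₗ[ℝ] (W →L[ℝ] ℝ)).toLinearMap ∘ₗ B)
    exact (B'.continuous.clm_apply continuous_id : Continuous fun x => B' x x)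
  rcases subsingleton_or_nontrivial W with hW | hW
  · refine ⟨1, one_pos, fun φ _ => ?_⟩
    have : φ = 0 := Subsingleton.elim _ _
    rw [this, norm_zero]
    exact zero_le_one
  have hne : (Metric.sphere (0 : W) 1).Nonempty := NormedSpace.sphere_nonempty.2 zero_le_one
  obtain ⟨x₀, hx₀, hmin⟩ := (isCompact_sphere (0 : W) 1).exists_isMinOn hne hcont.continuousOn
  obtain ⟨x₁, hx₁, hmax⟩ := (isCompact_sphere (0 : W) 1).exists_isMaxOn hne hcont.continuousOn
  have hn : ∀ x ∈ Metric.sphere (0 : W) 1, x ≠ 0 := fun x hx h => by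
    simp [h] at hx
  set m := B x₀ x₀
  set M := B x₁ x₁
  have hm : 0 < m := hB x₀ (hn x₀ hx₀)
  have hM : 0 < M := hB x₁ (hn x₁ hx₁)
  have hscale : ∀ x : W, x ≠ 0 → B x x = ‖x‖ ^ 2 * B (‖x‖⁻¹ • x) (‖x‖⁻¹ • x) := fun x hx => by
    have : ‖x‖ ≠ 0 := norm_ne_zero_iff.2 hx
    rw [map_smul, map_smul, LinearMap.smul_apply, smul_eq_mul, smul_eq_mul]
    field_simp
  have hsph : ∀ x : W, x ≠ 0 → ‖x‖⁻¹ • x ∈ Metric.sphere (0 : W) 1 := fun x hx => by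
    rw [mem_sphere_zero_iff_norm, norm_smul, norm_inv, norm_norm,
      inv_mul_cancel₀ (norm_ne_zero_iff.2 hx)]
  have hlow : ∀ x : W, m * ‖x‖ ^ 2 ≤ B x x := fun x => by
    rcases eq_or_ne x 0 with rfl | hx
    · simp
    · rw [hscale x hx, mul_comm]
      exact mul_le_mul_of_nonneg_left (hmin (hsph x hx)) (by positivity)
  have hup : ∀ x : W, B x x ≤ M * ‖x‖ ^ 2 := fun x => by
    rcases eq_or_ne x 0 with rfl | hx
    · simp
    · rw [hscale x hx, mul_comm M]
      exact mul_le_mul_of_nonneg_left (hmax (hsph x hx)) (by positivity)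
  refine ⟨√(M / m), Real.sqrt_pos.2 (by positivity), fun φ hφ => ?_⟩
  refine φ.opNorm_le_bound (Real.sqrt_nonneg _) fun x => ?_
  have h1 : m * ‖φ x‖ ^ 2 ≤ M * ‖x‖ ^ 2 := (hlow (φ x)).trans ((hφ x).le.trans (hup x))
  refine abs_le_of_sq_le_sq' ?_ (by positivity) |>.2
  rw [mul_pow, Real.sq_sqrt (by positivity), div_mul_eq_mul_div, le_div_iff₀ hm, mul_comm]
  exact h1

variable {E : Type*} [NormedAddCommGroup E] [NormedSpace ℝ E] [FiniteDimensional ℝ E]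
  [CompleteSpace E]
  {G : Type*} [TopologicalSpace G] [ChartedSpace E G] [Group G] [LieGroup 𝓘(ℝ, E) ∞ G]
  (D : IwasawaData (GroupLieAlgebra 𝓘(ℝ, E) G))

/-- The subgroup `K` of those `g` for which `Ad g` commutes with the Cartan involution. -/
def cartanSubgroup : Subgroup G where
  carrier := {g | ∀ X, D.θ (lieAd g X) = lieAd g (D.θ X)}
  one_mem' := fun X => by rw [lieAd_one]; rfl
  mul_mem' := fun {g h} hg hh X => by
    rw [lieAd_mul, LinearMap.comp_apply, LinearMap.comp_apply, hg, hh]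
  inv_mem' := fun {g} hg X => by
    have h1 : ∀ Y, lieAd (E := E) g⁻¹ (lieAd (E := E) g Y) = Y :=
      groupAd_inv_apply_self (E := E) g
    have h2 : ∀ Y, lieAd (E := E) g (lieAd (E := E) g⁻¹ Y) = Y :=
      groupAd_apply_inv_self (E := E) g
    have h3 := hg (lieAd g⁻¹ X)
    rw [h2] at h3
    rw [h3, h1]

/-- `Ad K` is bounded, as it preserves `B_θ`. -/
theorem exists_norm_groupAd_le :
    ∃ c : ℝ, 0 < c ∧ ∀ k ∈ cartanSubgroup D, ‖(groupAd k : E →L[ℝ] E)‖ ≤ c := by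
  obtain ⟨c, hc, h⟩ := exists_norm_le_of_preserves_posDef (W := E) D.form
    (fun x hx => D.form_pos hx)
  refine ⟨c, hc, fun k hk => h _ fun x => ?_⟩
  have key : ∀ X : GroupLieAlgebra 𝓘(ℝ, E) G, D.form (lieAd k X) (lieAd k X) = D.form X X := by
    intro X
    rw [D.form_apply, hk X, D.form_apply]
    exact congrArg Neg.neg (LieAlgebra.killingForm_of_equiv_apply (lieAdEquiv k) X (D.θ X))
  exact key x

/-- A subspace is `Ad g`-invariant as soon as `Ad g` maps it into itself. -/
theorem mem_adNormalizer_of_le {p : Submodule ℝ (GroupLieAlgebra 𝓘(ℝ, E) G)} {g : G}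
    (h : ∀ X ∈ p, lieAd g X ∈ p) : g ∈ adNormalizer p := by
  have hle : p.map (lieAd g) ≤ p := Submodule.map_le_iff_le_comap.2 h
  exact Submodule.eq_of_le_of_finrank_eq hle ((lieAdEquiv (E := E) g).toLinearEquiv.finrank_map_eq p)

/-- `ker Ad` is contained in every normalizer, in the form used for passing from `Ad G` to `G / P_C`. -/
theorem inv_mul_mem_adNormalizer {p : Submodule ℝ (GroupLieAlgebra 𝓘(ℝ, E) G)} {g h : G}
    (hgh : (groupAd g : E →L[ℝ] E) = groupAd h) : g⁻¹ * h ∈ adNormalizer p := by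
  refine mem_adNormalizer_of_le fun X hX => ?_
  have : (groupAd (g⁻¹ * h) : E →L[ℝ] E) = 1 := by
    rw [groupAd_mul, ← hgh, ← groupAd_mul, inv_mul_cancel, groupAd_one]
  have h2 : lieAd (g⁻¹ * h) X = X := congrArg (fun T : E →L[ℝ] E => T X) this
  rwa [h2]

theorem mem_cartanSubgroup_of_groupAd_eq_exp {X : GroupLieAlgebra 𝓘(ℝ, E) G} (hX : D.θ X = X)
    {k : G} (hk : (groupAd k : E →L[ℝ] E) = exp (groupBracket E G X)) :
    k ∈ cartanSubgroup D := by
  let T : E →L[ℝ] E := LinearMap.toContinuousLinearMap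
    (D.θ : GroupLieAlgebra 𝓘(ℝ, E) G →ₗ[ℝ] GroupLieAlgebra 𝓘(ℝ, E) G)
  have hT : Commute T (groupBracket E G (X : E)) := by
    refine ContinuousLinearMap.ext fun x => ?_
    have key : ∀ Y : GroupLieAlgebra 𝓘(ℝ, E) G, D.θ (groupBracket E G (X : E) (Y : E)) =
        groupBracket E G (X : E) (D.θ Y : E) := fun Y => by
      have h1 := groupBracket_apply X Y
      have h2 := groupBracket_apply X (D.θ Y)
      rw [h1]
      refine Eq.trans ?_ h2.symm
      have h3 := LieEquiv.map_lie D.θ X Y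
      rwa [hX] at h3
    exact key x
  intro Y
  let _ : NormedAlgebra ℚ (E →L[ℝ] E) := NormedAlgebra.restrictScalars ℚ ℝ _
  have h := hT.exp_right
  rw [← hk] at h
  exact congrArg (fun S : E →L[ℝ] E => S Y) h

theorem mem_adNormalizer_parabolic_of_groupAd_eq_exp {C : Set D.𝔞}
    {X : GroupLieAlgebra 𝓘(ℝ, E) G} (hX : X ∈ D.parabolic C)
    {p : G} (hp : (groupAd p : E →L[ℝ] E) = exp (groupBracket E G X)) :
    p ∈ adNormalizer (D.parabolic C) := by
  refine mem_adNormalizer_of_le fun Y hY => ?_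
  let q : Submodule ℝ E := D.parabolic C
  have h := exp_apply_mem (W := E) (T := groupBracket E G (X : E)) (p := q)
    q.closed_of_finiteDimensional (fun Z hZ => ?_) hY
  · rw [← hp] at h
    exact h
  · have key : ∀ Z : GroupLieAlgebra 𝓘(ℝ, E) G, Z ∈ D.parabolic C →
        (groupBracket E G (X : E) (Z : E) : GroupLieAlgebra 𝓘(ℝ, E) G) ∈ D.parabolic C :=
      fun Z hZ => by
        have h1 := groupBracket_apply X Z
        rw [h1]
        exact D.lie_mem_parabolic _ hX hZ
    exact key Z hZ

/-- `Ad (K P_C)` is a neighbourhood of the identity in the automorphism group, since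
`𝔨 + 𝔭_C = 𝔤`. -/
theorem eventually_exists_groupAd_mul_eq (C : Set D.𝔞)
    (hC : D.roots ⊆ D.rootsZero C ∪ D.rootsPos C ∪ D.rootsNeg C) :
    ∀ᶠ φ : E →L[ℝ] E in 𝓝 1, (∀ x y, φ (groupBracket E G x y) = groupBracket E G (φ x) (φ y)) →
      ∃ k ∈ cartanSubgroup D, ∃ p ∈ adNormalizer (D.parabolic C),
        φ = groupAd k * groupAd p := by
  -- linear maps `a`, `b` with values in `𝔨` and `𝔭_C` and sum the identity
  obtain ⟨s, hs⟩ := (D.𝔨.subtype.coprod (D.parabolic C).subtype).exists_rightInverse_of_surjective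
    (by rw [LinearMap.range_coprod, Submodule.range_subtype, Submodule.range_subtype,
      D.𝔨_sup_parabolic _ hC])
  let a : E →L[ℝ] E := LinearMap.toContinuousLinearMap
    (D.𝔨.subtype ∘ₗ LinearMap.fst ℝ _ _ ∘ₗ s)
  let b : E →L[ℝ] E := LinearMap.toContinuousLinearMap
    ((D.parabolic C).subtype ∘ₗ LinearMap.snd ℝ _ _ ∘ₗ s)
  have ha : ∀ X : GroupLieAlgebra 𝓘(ℝ, E) G, D.θ (a X) = a X := fun X => (s X).1.2
  have hb : ∀ X : GroupLieAlgebra 𝓘(ℝ, E) G,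
      (b X : GroupLieAlgebra 𝓘(ℝ, E) G) ∈ D.parabolic C := fun X => (s X).2.2
  have hab : ∀ X : E, a X + b X = X := fun X => congrArg (fun f => f X) hs
  let u : E → E →L[ℝ] E := fun X => exp (groupBracket E G (a X)) * exp (groupBracket E G (b X))
  have hu0 : u 0 = 1 := by simp [u]
  have hu : HasStrictFDerivAt u (groupBracket E G) 0 := by
    refine (hasStrictFDerivAt_exp_mul_exp ((groupBracket E G).comp a)
      ((groupBracket E G).comp b)).congr_fderiv (ContinuousLinearMap.ext fun X => ?_)
    change groupBracket E G (a X) + groupBracket E G (b X) = groupBracket E G X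
    rw [← map_add, hab]
  have haut : ∀ X x y, u X (groupBracket E G x y) = groupBracket E G (u X x) (u X y) :=
    fun X x y => by
      simp only [u, mul_apply_eq_comp]
      rw [exp_apply_bilin (derivDefect_groupBracket _),
        exp_apply_bilin (derivDefect_groupBracket _)]
  filter_upwards [eventually_exists_eq_of_hasStrictFDerivAt D hu hu0 haut univ_mem] with φ h1 h2
  obtain ⟨X, -, rfl⟩ := h1 h2
  obtain ⟨k, hk⟩ := exists_groupAd_eq_exp D (a X)
  obtain ⟨p, hp⟩ := exists_groupAd_eq_exp D (b X)
  exact ⟨k, mem_cartanSubgroup_of_groupAd_eq_exp D (ha X) hk, p,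
    mem_adNormalizer_parabolic_of_groupAd_eq_exp D (hb X) hp, by rw [hk, hp]⟩

end FlagCompact

/-! ### The decomposition `G = K P` and compactness of the flag manifold -/

section KP

open Filter Topology NormedSpace

variable {E : Type*} [NormedAddCommGroup E] [NormedSpace ℝ E] [FiniteDimensional ℝ E]
  [CompleteSpace E]
  {G : Type*} [TopologicalSpace G] [ChartedSpace E G] [Group G] [LieGroup 𝓘(ℝ, E) ∞ G]
  (D : IwasawaData (GroupLieAlgebra 𝓘(ℝ, E) G))

/-- `Ad (K P_C)` is stable under multiplication by automorphisms close to the identity; the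
neighbourhood does not depend on the element of `Ad (K P_C)` because `Ad K` is bounded. -/
theorem eventually_mul_groupAd_mul_eq (C : Set D.𝔞)
    (hC : D.roots ⊆ D.rootsZero C ∪ D.rootsPos C ∪ D.rootsNeg C) :
    ∀ᶠ φ : E →L[ℝ] E in 𝓝 1, (∀ x y, φ (groupBracket E G x y) = groupBracket E G (φ x) (φ y)) →
      ∀ k ∈ cartanSubgroup D, ∀ p ∈ adNormalizer (D.parabolic C),
        ∃ k' ∈ cartanSubgroup D, ∃ p' ∈ adNormalizer (D.parabolic C),
          φ * (groupAd k * groupAd p) = groupAd k' * groupAd p' := by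
  obtain ⟨c, hc, hbound⟩ := exists_norm_groupAd_le D
  obtain ⟨ε, hε, h⟩ := Metric.eventually_nhds_iff.1 (eventually_exists_groupAd_mul_eq D C hC)
  refine Metric.eventually_nhds_iff.2 ⟨ε / (c * c), by positivity, fun φ hφ haut k hk p hp => ?_⟩
  have hkk : (groupAd k * groupAd k⁻¹ : E →L[ℝ] E) = 1 := by
    rw [← groupAd_mul, mul_inv_cancel, groupAd_one]
  have hkk' : (groupAd k⁻¹ * groupAd k : E →L[ℝ] E) = 1 := by
    rw [← groupAd_mul, inv_mul_cancel, groupAd_one]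
  obtain ⟨k', hk', p', hp', he⟩ := @h (groupAd k⁻¹ * φ * groupAd k) (by
    have h1 : (groupAd k⁻¹ * φ * groupAd k - 1 : E →L[ℝ] E) =
        groupAd k⁻¹ * (φ - 1) * groupAd k := by
      rw [mul_sub, sub_mul, mul_one, hkk']
    rw [dist_eq_norm, h1]
    rw [dist_eq_norm, lt_div_iff₀ (by positivity)] at hφ
    have h2 := hbound k hk
    have h3 := hbound k⁻¹ (inv_mem hk)
    calc ‖(groupAd k⁻¹ * (φ - 1) * groupAd k : E →L[ℝ] E)‖
        ≤ ‖(groupAd k⁻¹ : E →L[ℝ] E)‖ * ‖φ - 1‖ * ‖(groupAd k : E →L[ℝ] E)‖ :=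
          (norm_mul_le _ _).trans (mul_le_mul_of_nonneg_right (norm_mul_le _ _) (norm_nonneg _))
      _ ≤ c * ‖φ - 1‖ * c := by gcongr
      _ < ε := by linarith) (fun x y => by
    simp only [mul_apply_eq_comp]
    rw [groupAd_bracket, haut, groupAd_bracket])
  refine ⟨k * k', mul_mem hk hk', p' * p, mul_mem hp' hp, ?_⟩
  calc φ * (groupAd k * groupAd p)
      = (groupAd k * groupAd k⁻¹) * φ * groupAd k * groupAd p := by
        rw [hkk, one_mul, mul_assoc]
    _ = groupAd k * (groupAd k⁻¹ * φ * groupAd k) * groupAd p := by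
        simp only [mul_assoc]
    _ = groupAd (k * k') * groupAd (p' * p) := by
        rw [he, groupAd_mul, groupAd_mul]
        simp only [mul_assoc]

theorem exists_exp_groupBracket_eq (C : Set D.𝔞)
    (hC : D.roots ⊆ D.rootsZero C ∪ D.rootsPos C ∪ D.rootsNeg C) (X : E) :
    ∃ k ∈ cartanSubgroup D, ∃ p ∈ adNormalizer (D.parabolic C),
      exp (groupBracket E G X) = (groupAd k * groupAd p : E →L[ℝ] E) := by
  obtain ⟨n, hn, hn0⟩ := (((tendsto_exp_inv_smul (groupBracket E G X)).eventually
    (eventually_mul_groupAd_mul_eq D C hC)).and (eventually_gt_atTop 0)).exists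
  have hn' := hn (fun x y => exp_apply_bilin (by
    rw [← map_smul]
    exact derivDefect_groupBracket _) x y)
  have hpow : ∀ m : ℕ, ∃ k ∈ cartanSubgroup D, ∃ p ∈ adNormalizer (D.parabolic C),
      exp ((n : ℝ)⁻¹ • groupBracket E G X) ^ m = (groupAd k * groupAd p : E →L[ℝ] E) := by
    intro m
    induction m with
    | zero => exact ⟨1, one_mem _, 1, one_mem _, by rw [pow_zero, groupAd_one, one_mul]⟩
    | succ m ih =>
      obtain ⟨k, hk, p, hp, he⟩ := ih
      rw [pow_succ', he]
      exact hn' k hk p hp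
  rw [← exp_inv_smul_pow _ hn0]
  exact hpow n

/-- Polar decomposition of `Ad G`: every `g` is the product of an element of `K` and an element
acting as `exp (ad X)`. -/
theorem exists_mul_inv_mem_cartanSubgroup (g : G) :
    ∃ (h : G) (X : E), g * h⁻¹ ∈ cartanSubgroup D ∧ groupAd h = exp (groupBracket E G X) := by
  obtain ⟨X, n, b, c, hX, hb, hpol⟩ := D.exists_polar (lieAdEquiv g)
  obtain ⟨h, hh⟩ := exists_groupAd_eq_exp D X
  refine ⟨h, X, fun Y => ?_, hh⟩
  have hexp : ∀ (Z : GroupLieAlgebra 𝓘(ℝ, E) G) (c : ℝ), ⁅X, Z⁆ = c • Z →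
      lieAd h Z = Real.exp c • Z := fun Z c hZ => by
    have h1 : groupBracket E G (X : E) (Z : E) = c • (Z : E) :=
      (groupBracket_apply X Z).trans hZ
    have h2 := exp_apply_of_apply_eq_smul h1
    rw [← hh] at h2
    exact h2
  have h1 : ∀ j, lieAd h (b j) = Real.exp (c j) • b j := fun j => hexp _ _ (hb j)
  have h2 : ∀ j, lieAd h (D.θ (b j)) = Real.exp (-c j) • D.θ (b j) := fun j => by
    refine hexp _ _ ?_
    have h3 := LieEquiv.map_lie D.θ X (b j)
    rw [hb, hX, map_smul, neg_lie] at h3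
    rw [neg_smul, h3, neg_neg]
  have hinv : ∀ Z : GroupLieAlgebra 𝓘(ℝ, E) G, lieAd h⁻¹ (lieAd h Z) = Z :=
    groupAd_inv_apply_self (E := E) h
  have hinv' : ∀ Z : GroupLieAlgebra 𝓘(ℝ, E) G, lieAd h (lieAd h⁻¹ Z) = Z :=
    groupAd_apply_inv_self (E := E) h
  have h4 : ∀ j, lieAd h⁻¹ (D.θ (b j)) = Real.exp (c j) • D.θ (b j) := fun j => by
    have h5 := hinv (D.θ (b j))
    rw [h2, map_smul] at h5
    have h6 := congrArg (fun Z => Real.exp (c j) • Z) h5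
    simpa [smul_smul, ← Real.exp_add] using h6
  have h5 : ∀ j, D.θ (lieAd g (b j)) = Real.exp (2 * c j) • lieAd g (D.θ (b j)) := fun j => by
    have h6 := congrArg (fun Z => lieAdEquiv g (D.θ Z)) (hpol j)
    simp only [D.θ_involutive, map_smul, LieEquiv.apply_symm_apply] at h6
    exact h6
  have h6 : D.θ.toLinearMap ∘ₗ lieAd g =
      lieAd (g * h⁻¹) ∘ₗ D.θ.toLinearMap ∘ₗ lieAd h := b.ext fun j => by
    change D.θ (lieAd g (b j)) = lieAd (g * h⁻¹) (D.θ (lieAd h (b j)))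
    rw [h5, h1, lieAd_mul, map_smul, map_smul, LinearMap.comp_apply, h4, map_smul, smul_smul,
      ← Real.exp_add, two_mul]
  have h7 := congrArg (fun f => f (lieAd h⁻¹ Y)) h6
  have h8 : D.θ (lieAd g (lieAd h⁻¹ Y)) = lieAd (g * h⁻¹) (D.θ (lieAd h (lieAd h⁻¹ Y))) := h7
  rw [hinv'] at h8
  rw [← h8, lieAd_mul, LinearMap.comp_apply]

/-- The decomposition `G = K P_C`. -/
theorem exists_inv_mul_mem_adNormalizer (C : Set D.𝔞)
    (hC : D.roots ⊆ D.rootsZero C ∪ D.rootsPos C ∪ D.rootsNeg C) (g : G) :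
    ∃ k ∈ cartanSubgroup D, k⁻¹ * g ∈ adNormalizer (D.parabolic C) := by
  obtain ⟨h, X, hgh, hX⟩ := exists_mul_inv_mem_cartanSubgroup D g
  obtain ⟨k, hk, p, hp, he⟩ := exists_exp_groupBracket_eq D C hC X
  refine ⟨(g * h⁻¹) * k, mul_mem hgh hk, ?_⟩
  have h1 : (k * p)⁻¹ * h ∈ adNormalizer (D.parabolic C) :=
    inv_mul_mem_adNormalizer (by rw [groupAd_mul, ← he, hX])
  have h2 := mul_mem hp h1
  have h3 : (g * h⁻¹ * k)⁻¹ * g = p * ((k * p)⁻¹ * h) := by group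
  rwa [h3]

/-- The flag manifold is compact: `Ad K` is totally bounded, so that `K` is covered by finitely
many translates of `N · ker Ad`, `N` a compact neighbourhood of `1`. -/
theorem compactSpace_flagManifold (C : Set D.𝔞)
    (hC : D.roots ⊆ D.rootsZero C ∪ D.rootsPos C ∪ D.rootsNeg C) :
    CompactSpace (FlagManifold D C) := by
  have _ : LocallyCompactSpace G := Manifold.locallyCompact_of_finiteDimensional 𝓘(ℝ, E)
  obtain ⟨N, hNc, hN⟩ := exists_compact_mem_nhds (1 : G)
  obtain ⟨c, hc, hbound⟩ := exists_norm_groupAd_le D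
  obtain ⟨ε, hε, h⟩ := Metric.eventually_nhds_iff.1 (eventually_exists_groupAd_eq D hN)
  let S : Set (E →L[ℝ] E) := groupAd '' (cartanSubgroup D : Set G)
  have hS : TotallyBounded S := by
    refine (isCompact_closedBall (0 : E →L[ℝ] E) c).totallyBounded.subset ?_
    rintro _ ⟨k, hk, rfl⟩
    exact mem_closedBall_zero_iff.2 (hbound k hk)
  obtain ⟨t, htS, htf, hcov⟩ := Metric.finite_approx_of_totallyBounded hS (ε / c) (by positivity)
  choose! κ hκ hκ' using fun s (hs : s ∈ t) => htS hs
  have hfin : IsCompact (⋃ s ∈ t, (fun g : G => ((κ s * g : G) : FlagManifold D C)) '' N) := by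
    refine htf.isCompact_biUnion fun s _ => hNc.image ?_
    exact continuous_quotient_mk'.comp (by
      have _ := topologicalGroup_of_lieGroup 𝓘(ℝ, E) ∞ (G := G)
      exact continuous_const_mul (κ s))
  refine ⟨hfin.of_isClosed_subset isClosed_univ fun x _ => ?_⟩
  obtain ⟨g, rfl⟩ := QuotientGroup.mk_surjective x
  obtain ⟨k, hk, hkg⟩ := exists_inv_mul_mem_adNormalizer D C hC g
  obtain ⟨s, hs, hks⟩ := Set.mem_iUnion₂.1 (hcov ⟨k, hk, rfl⟩)
  obtain ⟨n, hn, he⟩ := @h (groupAd (κ s)⁻¹ * groupAd k) (by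
    have h1 : (groupAd (κ s)⁻¹ * groupAd k - 1 : E →L[ℝ] E) =
        groupAd (κ s)⁻¹ * (groupAd k - s) := by
      have h2 : (groupAd (κ s)⁻¹ * s : E →L[ℝ] E) = 1 := by
        have h3 := groupAd_mul (E := E) (κ s)⁻¹ (κ s)
        rw [inv_mul_cancel, groupAd_one, hκ' s hs] at h3
        exact h3.symm
      rw [mul_sub, h2]
    rw [Metric.mem_ball, dist_eq_norm, lt_div_iff₀ hc] at hks
    rw [dist_eq_norm, h1]
    calc ‖(groupAd (κ s)⁻¹ * (groupAd k - s) : E →L[ℝ] E)‖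
        ≤ ‖(groupAd (κ s)⁻¹ : E →L[ℝ] E)‖ * ‖groupAd k - s‖ := norm_mul_le _ _
      _ ≤ c * ‖groupAd k - s‖ := by
        gcongr
        exact hbound _ (inv_mem (hκ s hs))
      _ < ε := by linarith) (fun x y => by
    simp only [mul_apply_eq_comp]
    rw [groupAd_bracket, groupAd_bracket])
  refine Set.mem_iUnion₂.2 ⟨s, hs, n, hn, ?_⟩
  refine QuotientGroup.eq.2 ?_
  have h1 : (κ s * n)⁻¹ * k ∈ adNormalizer (D.parabolic C) :=
    inv_mul_mem_adNormalizer (by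
      rw [groupAd_mul, he, ← mul_assoc, ← groupAd_mul, mul_inv_cancel, groupAd_one, one_mul])
  have h2 := mul_mem h1 hkg
  have h3 : (κ s * n)⁻¹ * k * (k⁻¹ * g) = (κ s * n)⁻¹ * g := by group
  rwa [h3] at h2

end KP

/-! ### Compactness of the co-sphere bundle -/

section CosphereCompact

open Filter Topology Bundle

variable {B : Type*} [TopologicalSpace B]
  {F : Type*} [NormedAddCommGroup F] [NormedSpace ℝ F]
  {E : B → Type*} [TopologicalSpace (TotalSpace F E)] [∀ x, NormedAddCommGroup (E x)]
  [∀ x, InnerProductSpace ℝ (E x)]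
  [FiberBundle F E] [VectorBundle ℝ F E]

/-- The preferred trivialization of the dual bundle sends `(x, ξ)` to the expression of `ξ` in the
preferred trivialization of the bundle. -/
theorem dual_trivializationAt_apply (x₀ : B)
    (p : TotalSpace (F →L[ℝ] ℝ) (fun x => E x →L[ℝ] ℝ)) :
    trivializationAt (F →L[ℝ] ℝ) (fun x => E x →L[ℝ] ℝ) x₀ p =
      (p.1, p.2.comp ((trivializationAt F E x₀).symmL ℝ p.1)) := by
  refine (hom_trivializationAt_apply (RingHom.id ℝ) x₀ p).trans ?_
  congr 1
  ext v
  simp [ContinuousLinearMap.inCoordinates]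

theorem dual_tendsto_nhds_iff {α : Type*} {l : Filter α}
    {f : α → TotalSpace (F →L[ℝ] ℝ) (fun x => E x →L[ℝ] ℝ)}
    {q : TotalSpace (F →L[ℝ] ℝ) (fun x => E x →L[ℝ] ℝ)} :
    Tendsto f l (𝓝 q) ↔ Tendsto (fun a => (f a).1) l (𝓝 q.1) ∧
      Tendsto (fun a => ((f a).2.comp ((trivializationAt F E q.1).symmL ℝ (f a).1) : F →L[ℝ] ℝ)) l
        (𝓝 (q.2.comp ((trivializationAt F E q.1).symmL ℝ q.1))) := by
  have h := (trivializationAt (F →L[ℝ] ℝ) (fun x => E x →L[ℝ] ℝ) q.1).tendsto_nhds_iff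
    (f := f) (l := l) (z := q) (FiberBundle.mem_trivializationAt_proj_source)
  simp only [dual_trivializationAt_apply] at h
  exact h

/-- A continuous section of a bundle defines a continuous, fibrewise linear function on the total
space of the dual bundle. -/
theorem continuous_dual_apply {v : ∀ x, E x} (hv : Continuous fun x => TotalSpace.mk' F x (v x)) :
    Continuous fun p : TotalSpace (F →L[ℝ] ℝ) (fun x => E x →L[ℝ] ℝ) => p.2 (v p.1) := by
  refine continuous_iff_continuousAt.2 fun q => ?_
  set e := trivializationAt F E q.1 with he
  have hmem : q.1 ∈ e.baseSet := FiberBundle.mem_baseSet_trivializationAt' q.1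
  obtain ⟨hp, hη⟩ := dual_tendsto_nhds_iff.1 (tendsto_id (x := 𝓝 q))
  have h1 := ((FiberBundle.continuousAt_totalSpace F _).1 (hv.continuousAt (x := q.1))).2
  have h5 : Tendsto (fun p : TotalSpace (F →L[ℝ] ℝ) (fun x => E x →L[ℝ] ℝ) =>
      (e ⟨p.1, v p.1⟩).2) (𝓝 q) (𝓝 (e ⟨q.1, v q.1⟩).2) :=
    Tendsto.comp (g := fun x => (e ⟨x, v x⟩).2) h1 hp
  have h2 : ContinuousAt (fun p : TotalSpace (F →L[ℝ] ℝ) (fun x => E x →L[ℝ] ℝ) =>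
      (p.2.comp (e.symmL ℝ p.1) : F →L[ℝ] ℝ) ((e ⟨p.1, v p.1⟩).2)) q :=
    ContinuousAt.clm_apply hη h5
  refine h2.congr_of_eventuallyEq ?_
  filter_upwards [hp.eventually (e.open_baseSet.mem_nhds hmem)] with p h3'
  have h3 : p.1 ∈ e.baseSet := h3'
  have h4 : (e ⟨p.1, v p.1⟩).2 = e.continuousLinearMapAt ℝ p.1 (v p.1) := by
    rw [Trivialization.continuousLinearMapAt_apply, Trivialization.coe_linearMapAt_of_mem e h3]
  rw [h4, ContinuousLinearMap.comp_apply, Trivialization.symmL_continuousLinearMapAt _ h3]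

variable [IsContinuousRiemannianBundle F E]

/-- The dual norm is continuous: for `r > 1` and `x` near `x₀`, the trivialization identifies the
fibres over `x` and `x₀` up to a factor `r` on norms. -/
theorem continuous_norm_dual :
    Continuous fun p : TotalSpace (F →L[ℝ] ℝ) (fun x => E x →L[ℝ] ℝ) => ‖p.2‖ := by
  refine continuous_iff_continuousAt.2 fun q => ?_
  set e := trivializationAt F E q.1 with he
  have hp : Tendsto (fun p : TotalSpace (F →L[ℝ] ℝ) (fun x => E x →L[ℝ] ℝ) => p.1) (𝓝 q)
      (𝓝 q.1) := (dual_tendsto_nhds_iff.1 tendsto_id).1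
  have hη := (dual_tendsto_nhds_iff.1 (tendsto_id (x := 𝓝 q))).2
  -- `ζ p` is the covector `p` carried to the fibre over the base point of `q`
  let ζ : TotalSpace (F →L[ℝ] ℝ) (fun x => E x →L[ℝ] ℝ) → E q.1 →L[ℝ] ℝ := fun p =>
    (p.2.comp (e.symmL ℝ p.1)).comp (e.continuousLinearMapAt ℝ q.1)
  have hmem : q.1 ∈ e.baseSet := FiberBundle.mem_baseSet_trivializationAt' q.1
  have hζq : ζ q = q.2 := by
    ext v
    simp [ζ, hmem]
  have hζ : Tendsto (fun p => ‖ζ p‖) (𝓝 q) (𝓝 ‖q.2‖) := by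
    rw [← hζq]
    exact (((ContinuousLinearMap.compL ℝ (E q.1) F ℝ).flip
      (e.continuousLinearMapAt ℝ q.1)).continuous.tendsto _ |>.comp hη).norm
  have hle : ∀ r : ℝ, 1 < r → ∀ᶠ p in 𝓝 q, ‖p.2‖ ≤ ‖ζ p‖ * r ∧ ‖ζ p‖ ≤ ‖p.2‖ * r := by
    intro r hr
    filter_upwards [hp.eventually (eventually_norm_symmL_trivializationAt_self_comp_lt F E q.1 hr),
      hp.eventually (eventually_norm_symmL_trivializationAt_comp_self_lt F E q.1 hr),
      hp.eventually (e.open_baseSet.mem_nhds hmem)] with p h1 h2 h3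
    constructor
    · have h4 : p.2 = (ζ p).comp ((e.symmL ℝ q.1).comp (e.continuousLinearMapAt ℝ p.1)) := by
        ext v
        simp only [ζ, ContinuousLinearMap.comp_apply]
        rw [Trivialization.continuousLinearMapAt_symmL _ hmem,
          Trivialization.symmL_continuousLinearMapAt _ h3]
      conv_lhs => rw [h4]
      exact (ContinuousLinearMap.opNorm_comp_le _ _).trans
        (mul_le_mul_of_nonneg_left h1.le (norm_nonneg _))
    · exact (ContinuousLinearMap.opNorm_comp_le p.2
        ((e.symmL ℝ p.1).comp (e.continuousLinearMapAt ℝ q.1))).trans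
        (mul_le_mul_of_nonneg_left h2.le (norm_nonneg _))
  refine tendsto_order.2 ⟨fun a ha => ?_, fun a ha => ?_⟩
  · obtain ⟨r, hr, har⟩ : ∃ r : ℝ, 1 < r ∧ a * r < ‖q.2‖ := by
      have h1 : ∀ᶠ r : ℝ in 𝓝[>] 1, a * r < ‖q.2‖ := by
        have : Tendsto (fun r : ℝ => a * r) (𝓝[>] 1) (𝓝 (a * 1)) :=
          ((continuous_const.mul continuous_id).tendsto 1).mono_left nhdsWithin_le_nhds
        rw [mul_one] at this
        exact this.eventually (gt_mem_nhds ha)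
      obtain ⟨r, h2, h3⟩ := (h1.and self_mem_nhdsWithin).exists
      exact ⟨r, h3, h2⟩
    filter_upwards [hle r hr, hζ.eventually (lt_mem_nhds har)] with p h1 h2
    exact lt_of_mul_lt_mul_right (h2.trans_le h1.2) (by linarith)
  · obtain ⟨r, hr, har⟩ : ∃ r : ℝ, 1 < r ∧ ‖q.2‖ < a / r := by
      have h1 : ∀ᶠ r : ℝ in 𝓝[>] 1, ‖q.2‖ * r < a := by
        have : Tendsto (fun r : ℝ => ‖q.2‖ * r) (𝓝[>] 1) (𝓝 (‖q.2‖ * 1)) :=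
          ((continuous_const.mul continuous_id).tendsto 1).mono_left nhdsWithin_le_nhds
        rw [mul_one] at this
        exact this.eventually (gt_mem_nhds ha)
      obtain ⟨r, h2, h3⟩ := (h1.and self_mem_nhdsWithin).exists
      have h4 : (0 : ℝ) < r := zero_lt_one.trans h3
      exact ⟨r, h3, (lt_div_iff₀ h4).2 h2⟩
    filter_upwards [hle r hr, hζ.eventually (gt_mem_nhds har)] with p h1 h2
    exact h1.1.trans_lt ((lt_div_iff₀ (zero_lt_one.trans hr)).1 h2)

/-- The unit sphere bundle of the dual of a finite-dimensional Riemannian bundle over a compact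
base is compact. -/
theorem isCompact_dual_sphere [CompactSpace B] [FiniteDimensional ℝ F] :
    IsCompact {p : TotalSpace (F →L[ℝ] ℝ) (fun x => E x →L[ℝ] ℝ) | ‖p.2‖ = 1} := by
  have _ : ProperSpace (F →L[ℝ] ℝ) := FiniteDimensional.proper ℝ _
  -- along an ultrafilter, the base points converge, and so do the coordinates of the covectors,
  -- which are bounded
  refine isCompact_iff_ultrafilter_le_nhds.2 fun f hf => ?_
  have hf1 : ∀ᶠ p in (f : Filter (TotalSpace (F →L[ℝ] ℝ) (fun x => E x →L[ℝ] ℝ))), ‖p.2‖ = 1 :=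
    le_principal_iff.1 hf
  obtain ⟨x, -, hx⟩ := isCompact_iff_ultrafilter_le_nhds.1 (isCompact_univ (X := B))
    (f.map fun p => p.1) (by simp)
  have hx' : Tendsto (fun p : TotalSpace (F →L[ℝ] ℝ) (fun x => E x →L[ℝ] ℝ) => p.1) f (𝓝 x) := hx
  obtain ⟨c, hc, hc'⟩ := eventually_norm_symmL_trivializationAt_lt F E x
  set e := trivializationAt F E x with he
  obtain ⟨η, -, hη⟩ := isCompact_iff_ultrafilter_le_nhds.1
    (isCompact_closedBall (0 : F →L[ℝ] ℝ) c)
    (f.map fun p => (p.2.comp (e.symmL ℝ p.1) : F →L[ℝ] ℝ)) (by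
      refine le_principal_iff.2 ?_
      change ∀ᶠ p in (f : Filter (TotalSpace (F →L[ℝ] ℝ) (fun x => E x →L[ℝ] ℝ))), _
      filter_upwards [hf1, hx'.eventually hc'] with p h1 h2
      refine mem_closedBall_zero_iff.2 ((ContinuousLinearMap.opNorm_comp_le _ _).trans ?_)
      rw [h1, one_mul]
      exact h2.le)
  have hmem : x ∈ e.baseSet := FiberBundle.mem_baseSet_trivializationAt' x
  let q : TotalSpace (F →L[ℝ] ℝ) (fun x => E x →L[ℝ] ℝ) :=
    ⟨x, η.comp (e.continuousLinearMapAt ℝ x)⟩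
  have hq : q.2.comp (e.symmL ℝ x) = η := by
    ext v
    simp [q, hmem]
  have hlim : Tendsto id (f : Filter _) (𝓝 q) :=
    dual_tendsto_nhds_iff.2 ⟨hx', by
      change Tendsto _ _ (𝓝 (q.2.comp (e.symmL ℝ x)))
      rw [hq]
      exact hη⟩
  refine ⟨q, ?_, hlim⟩
  have h1 : Tendsto (fun p : TotalSpace (F →L[ℝ] ℝ) (fun x => E x →L[ℝ] ℝ) => ‖p.2‖) f
      (𝓝 ‖q.2‖) := (continuous_norm_dual.tendsto q).comp hlim
  exact tendsto_nhds_unique h1 ((tendsto_congr' hf1).2 tendsto_const_nhds)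

variable {V : Type*} [NormedAddCommGroup V] [NormedSpace ℝ V]
  {M : Type*} [TopologicalSpace M] [ChartedSpace V M] [IsManifold 𝓘(ℝ, V) ∞ M]
  [Bundle.RiemannianBundle (fun x : M => TangentSpace 𝓘(ℝ, V) x)]
  [IsContMDiffRiemannianBundle 𝓘(ℝ, V) ∞ V (fun x : M => TangentSpace 𝓘(ℝ, V) x)]

theorem isContinuousRiemannianBundle_tangentSpace :
    IsContinuousRiemannianBundle V (fun x : M => TangentSpace 𝓘(ℝ, V) x) := by
  obtain ⟨g, hg, h⟩ := ‹IsContMDiffRiemannianBundle 𝓘(ℝ, V) ∞ V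
    (fun x : M => TangentSpace 𝓘(ℝ, V) x)›.exists_contMDiff
  exact ⟨g, hg.continuous, h⟩

theorem isCompact_cosphereBundle [FiniteDimensional ℝ V] [CompactSpace M] : IsCompact (cosphereBundle V M) :=
  have := isContinuousRiemannianBundle_tangentSpace (V := V) (M := M)
  isCompact_dual_sphere (F := V) (E := fun x : M => TangentSpace 𝓘(ℝ, V) x)

end CosphereCompact

/-! ### Smooth actions and the moment map -/

section HomogeneousSpace

open Filter Topology Bundle

/-- Submersions have local sections. -/
theorem exists_local_section {E V : Type*} [NormedAddCommGroup E] [NormedSpace ℝ E]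
    [NormedAddCommGroup V] [NormedSpace ℝ V]
    {N M : Type*} [TopologicalSpace N] [ChartedSpace E N]
    [TopologicalSpace M] [ChartedSpace V M] {f : N → M} {x : N}
    (hf : Manifold.IsSubmersionAt 𝓘(ℝ, E) 𝓘(ℝ, V) ∞ f x) :
    ∃ σ : M → N, ContMDiffAt 𝓘(ℝ, V) 𝓘(ℝ, E) ∞ σ (f x) ∧ σ (f x) = x ∧
      ∀ᶠ y in 𝓝 (f x), f (σ y) = y := by
  -- in suitable charts `f` is the projection `(u, v) ↦ u`, with section `u ↦ (u, v(x))`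
  obtain ⟨F, _, _, h⟩ := hf
  let φ := h.domChart
  let ψ := h.codChart
  let e := h.equiv
  have hx : x ∈ φ.source := h.mem_domChart_source
  have hfx : f x ∈ ψ.source := h.mem_codChart_source
  have hchart : ∀ u ∈ φ.target, ψ (f (φ.symm u)) = (e u).1 := fun u hu => by
    have := h.writtenInCharts
      (show u ∈ (h.domChart.extend 𝓘(ℝ, E)).target by simpa using hu)
    simpa [OpenPartialHomeomorph.extend] using this
  let c : V → E := fun w => e.symm (w, (e (φ x)).2)
  have hcx : c (ψ (f x)) = φ x := by
    have h1 : ψ (f x) = (e (φ x)).1 := by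
      rw [← hchart _ (φ.map_source hx), φ.left_inv hx]
    simp [c, h1]
  have hc : ContDiff ℝ ∞ c := by fun_prop
  have hψ : ContMDiffAt 𝓘(ℝ, V) 𝓘(ℝ, V) ∞ ψ (f x) :=
    contMDiffAt_of_mem_maximalAtlas h.codChart_mem_maximalAtlas hfx
  have hφ : ContMDiffAt 𝓘(ℝ, E) 𝓘(ℝ, E) ∞ φ.symm (c (ψ (f x))) :=
    contMDiffAt_symm_of_mem_maximalAtlas h.domChart_mem_maximalAtlas
      (by rw [hcx]; exact φ.map_source hx)
  have hcψ : ContMDiffAt 𝓘(ℝ, V) 𝓘(ℝ, E) ∞ (fun y => c (ψ y)) (f x) :=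
    hc.contMDiff.contMDiffAt.comp (f x) hψ
  refine ⟨fun y => φ.symm (c (ψ y)), hφ.comp (f x) hcψ, by simp only [hcx, φ.left_inv hx], ?_⟩
  have h1 : ∀ᶠ y in 𝓝 (f x), c (ψ y) ∈ φ.target :=
    hcψ.continuousAt (φ.open_target.mem_nhds (by rw [hcx]; exact φ.map_source hx))
  filter_upwards [h1, ψ.open_source.mem_nhds hfx] with y h2 h3
  have h4 : f (φ.symm (c (ψ y))) ∈ ψ.source :=
    h.source_subset_preimage_source (φ.map_target h2)
  refine ψ.injOn h4 h3 ?_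
  rw [hchart _ h2]
  simp [c]

variable {E : Type*} [NormedAddCommGroup E] [NormedSpace ℝ E]
  {G : Type*} [TopologicalSpace G] [ChartedSpace E G] [Group G]
  {V : Type*} [NormedAddCommGroup V] [NormedSpace ℝ V]
  {M : Type*} [TopologicalSpace M] [ChartedSpace V M] [MulAction G M]

theorem contMDiff_const_smul_of_smul
    (hsmul : ContMDiff (𝓘(ℝ, E).prod 𝓘(ℝ, V)) 𝓘(ℝ, V) ∞ (fun p : G × M => p.1 • p.2))
    (g : G) : ContMDiff 𝓘(ℝ, V) 𝓘(ℝ, V) ∞ (fun y : M => g • y) :=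
  hsmul.comp (contMDiff_const.prodMk contMDiff_id)

theorem contMDiff_smul_const_of_smul
    (hsmul : ContMDiff (𝓘(ℝ, E).prod 𝓘(ℝ, V)) 𝓘(ℝ, V) ∞ (fun p : G × M => p.1 • p.2))
    (x : M) : ContMDiff 𝓘(ℝ, E) 𝓘(ℝ, V) ∞ (fun g : G => g • x) :=
  hsmul.comp (contMDiff_id.prodMk contMDiff_const)

/-- The moment map `μ : T*M → 𝔤*`, `μ(x, ξ)(Y) = ξ(X_Y(x))`. -/
def momentMap (p : CotangentBundle V M) : GroupLieAlgebra 𝓘(ℝ, E) G →ₗ[ℝ] ℝ :=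
  p.2.toLinearMap ∘ₗ fundamentalField p.1

theorem momentMap_apply (p : CotangentBundle V M) (Y : GroupLieAlgebra 𝓘(ℝ, E) G) :
    momentMap p Y = p.2 (fundamentalField p.1 Y) := rfl

/-- The derivative of the action of `g` is invertible, so that `ContinuousLinearMap.inverse` in the
definition of the lifted action does not take its junk value. -/
theorem inverse_mfderiv_smul
    (hsmul : ContMDiff (𝓘(ℝ, E).prod 𝓘(ℝ, V)) 𝓘(ℝ, V) ∞ (fun p : G × M => p.1 • p.2))
    (g : G) (x : M) :
    (mfderiv 𝓘(ℝ, V) 𝓘(ℝ, V) (fun y : M => g • y) x : V →L[ℝ] V).inverse =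
        (mfderiv 𝓘(ℝ, V) 𝓘(ℝ, V) (fun y : M => g⁻¹ • y) (g • x) : V →L[ℝ] V) ∧
      (mfderiv 𝓘(ℝ, V) 𝓘(ℝ, V) (fun y : M => g⁻¹ • y) (g • x) : V →L[ℝ] V).comp
        (mfderiv 𝓘(ℝ, V) 𝓘(ℝ, V) (fun y : M => g • y) x : V →L[ℝ] V) =
          ContinuousLinearMap.id ℝ V := by
  have hd : ∀ (g : G) (y : M), MDifferentiableAt 𝓘(ℝ, V) 𝓘(ℝ, V) (fun y : M => g • y) y :=
    fun g y => (contMDiff_const_smul_of_smul hsmul g).mdifferentiableAt (by simp)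
  have h1 := mfderiv_comp x (hd g⁻¹ (g • x)) (hd g x)
  have e1 : ((fun y : M => g⁻¹ • y) ∘ fun y => g • y) = id := by
    funext y; simp
  have e2 : ((fun y : M => g • y) ∘ fun y => g⁻¹ • y) = id := by
    funext y; simp
  have h2 := mfderiv_comp (g • x) (hd g (g⁻¹ • g • x)) (hd g⁻¹ (g • x))
  rw [e1, mfderiv_id] at h1
  rw [e2, mfderiv_id, inv_smul_smul] at h2
  exact ⟨ContinuousLinearMap.inverse_eq h2.symm h1.symm, h1.symm⟩

variable [LieGroup 𝓘(ℝ, E) ∞ G]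

/-- The action on a quotient is smooth: locally `g y = q (g σ(y))` for a section `σ` of `q`. -/
theorem contMDiff_smul_of_submersion {q : G → M} (hsurj : Function.Surjective q)
    (hequiv : ∀ g h, q (g * h) = g • q h)
    (hq : Manifold.IsSubmersion 𝓘(ℝ, E) 𝓘(ℝ, V) ∞ q) :
    ContMDiff (𝓘(ℝ, E).prod 𝓘(ℝ, V)) 𝓘(ℝ, V) ∞ (fun p : G × M => p.1 • p.2) := by
  rintro ⟨g, y⟩
  obtain ⟨k, rfl⟩ := hsurj y
  obtain ⟨σ, hσ, hσk, hsec⟩ := exists_local_section (hq.isSubmersionAt k)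
  have h1 : ContMDiffAt (𝓘(ℝ, E).prod 𝓘(ℝ, V)) 𝓘(ℝ, V) ∞
      (fun p : G × M => q (p.1 * σ p.2)) (g, q k) := by
    have h2 : ContMDiffAt (𝓘(ℝ, E).prod 𝓘(ℝ, V)) 𝓘(ℝ, E) ∞
        (fun p : G × M => p.1 * σ p.2) (g, q k) :=
      contMDiffAt_fst.mul (ContMDiffAt.comp (g, q k) (g := σ) (f := Prod.snd) hσ contMDiffAt_snd)
    exact ContMDiffAt.comp (g, q k) (g := q) hq.contMDiff.contMDiffAt h2
  refine h1.congr_of_eventuallyEq ?_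
  filter_upwards [continuousAt_snd.eventually hsec] with p hp
  rw [hequiv, hp]

/-- A transitive action is infinitesimally transitive: `y ↦ σ(y) k⁻¹`, with `σ` a local section of `q`
through `k`, is a section of the orbit map of `q k` through `1`. -/
theorem surjective_fundamentalField_of_submersion {q : G → M} (hsurj : Function.Surjective q)
    (hequiv : ∀ g h, q (g * h) = g • q h)
    (hq : Manifold.IsSubmersion 𝓘(ℝ, E) 𝓘(ℝ, V) ∞ q)
    (hsmul : ContMDiff (𝓘(ℝ, E).prod 𝓘(ℝ, V)) 𝓘(ℝ, V) ∞ (fun p : G × M => p.1 • p.2)) (x : M) :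
    Function.Surjective (fundamentalField (E := E) (G := G) (V := V) x) := by
  obtain ⟨k, rfl⟩ := hsurj x
  obtain ⟨σ, hσ, hσk, hsec⟩ := exists_local_section (hq.isSubmersionAt k)
  have h1 : ContMDiffAt 𝓘(ℝ, V) 𝓘(ℝ, E) ∞ (fun y => σ y * k⁻¹) (q k) :=
    hσ.mul contMDiffAt_const
  have h2 : MDifferentiableAt 𝓘(ℝ, E) 𝓘(ℝ, V) (fun g : G => g • q k) (σ (q k) * k⁻¹) := by
    have h3 : ContMDiff 𝓘(ℝ, E) 𝓘(ℝ, V) ∞ (fun g : G => g • q k) :=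
      hsmul.comp (contMDiff_id.prodMk contMDiff_const)
    exact h3.mdifferentiableAt (by simp)
  have h4 := mfderiv_comp (q k) h2 (h1.mdifferentiableAt (by simp))
  have h5 : ((fun g : G => g • q k) ∘ fun y => σ y * k⁻¹) =ᶠ[𝓝 (q k)] id := by
    filter_upwards [hsec] with y hy
    simp only [Function.comp_apply, id_eq]
    rw [← hequiv, inv_mul_cancel_right, hy]
  rw [h5.mfderiv_eq, mfderiv_id, hσk, mul_inv_cancel] at h4
  intro v
  exact ⟨(mfderiv 𝓘(ℝ, V) 𝓘(ℝ, E) (fun y => σ y * k⁻¹) (q k) : V →L[ℝ] E) v,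
    (congrArg (fun T : V →L[ℝ] V => T v) h4).symm⟩

/-- The fundamental fields of a smooth action are continuous. -/
theorem continuous_fundamentalField
    (hsmul : ContMDiff (𝓘(ℝ, E).prod 𝓘(ℝ, V)) 𝓘(ℝ, V) ∞ (fun p : G × M => p.1 • p.2))
    [IsManifold 𝓘(ℝ, V) ∞ M] (Y : GroupLieAlgebra 𝓘(ℝ, E) G) :
    Continuous fun x : M => TotalSpace.mk' V (E := fun x : M => TangentSpace 𝓘(ℝ, V) x) x
      (fundamentalField (E := E) (G := G) (V := V) x Y) := by
  refine continuous_iff_continuousAt.2 fun x₀ => ?_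
  rw [FiberBundle.continuousAt_totalSpace]
  refine ⟨continuousAt_id, ?_⟩
  have hf : ContMDiff (𝓘(ℝ, V).prod 𝓘(ℝ, E)) 𝓘(ℝ, V) ∞
      (Function.uncurry fun (x : M) (g : G) => g • x) :=
    hsmul.comp (contMDiff_snd.prodMk contMDiff_fst)
  have h := (ContMDiffAt.mfderiv (m := ∞) (n := ∞) (x₀ := x₀) (fun (x : M) (g : G) => g • x)
    (fun _ => (1 : G)) hf.contMDiffAt contMDiffAt_const le_rfl).continuousAt
  simp only [one_smul] at h
  have hm : ∀ᶠ x in 𝓝 x₀, x ∈ (trivializationAt V (TangentSpace 𝓘(ℝ, V) : M → Type _) x₀).baseSet :=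
    (trivializationAt V (TangentSpace 𝓘(ℝ, V)) x₀).open_baseSet.mem_nhds
      (FiberBundle.mem_baseSet_trivializationAt' x₀)
  let w : E := (trivializationAt E (TangentSpace 𝓘(ℝ, E) : G → Type _) 1).continuousLinearMapAt ℝ 1 Y
  have h2 := h.clm_apply (continuousAt_const (y := w))
  refine h2.congr_of_eventuallyEq ?_
  filter_upwards [hm] with x hx
  have h3 : (trivializationAt E (TangentSpace 𝓘(ℝ, E) : G → Type _) 1).symmL ℝ 1 w = Y :=
    Trivialization.symmL_continuousLinearMapAt _ (FiberBundle.mem_baseSet_trivializationAt' 1) Y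
  have h4 : inTangentCoordinates 𝓘(ℝ, E) 𝓘(ℝ, V) (fun _ : M => (1 : G)) (fun x : M => x)
      (fun x => mfderiv 𝓘(ℝ, E) 𝓘(ℝ, V) (fun g : G => g • x) 1) x₀ x w =
      (trivializationAt V (TangentSpace 𝓘(ℝ, V) : M → Type _) x₀).continuousLinearMapAt ℝ x
        (fundamentalField (E := E) (G := G) (V := V) x
        ((trivializationAt E (TangentSpace 𝓘(ℝ, E) : G → Type _) 1).symmL ℝ 1 w)) := rfl
  rw [h3, Trivialization.continuousLinearMapAt_apply, Trivialization.coe_linearMapAt_of_mem _ hx]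
    at h4
  exact h4.symm

/-- `X_Y(g x) = d_x g (X_{Ad(g⁻¹) Y}(x))`. -/
theorem fundamentalField_smul
    (hsmul : ContMDiff (𝓘(ℝ, E).prod 𝓘(ℝ, V)) 𝓘(ℝ, V) ∞ (fun p : G × M => p.1 • p.2))
    (g : G) (x : M) (Y : GroupLieAlgebra 𝓘(ℝ, E) G) :
    fundamentalField (V := V) (g • x) Y =
      (mfderiv 𝓘(ℝ, V) 𝓘(ℝ, V) (fun y : M => g • y) x : V →L[ℝ] V)
        (fundamentalField (V := V) x (lieAd g⁻¹ Y) : V) := by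
  have hconj := (contMDiff_conj (E := E) g⁻¹).mdifferentiableAt (x := 1) (by simp)
  have h1 : g⁻¹ * 1 * g⁻¹⁻¹ = 1 := by simp
  have horb : MDifferentiableAt 𝓘(ℝ, E) 𝓘(ℝ, V) (fun k : G => k • x) (g⁻¹ * 1 * g⁻¹⁻¹) :=
    (contMDiff_smul_const_of_smul hsmul x).mdifferentiableAt (by simp)
  have hg : MDifferentiableAt 𝓘(ℝ, V) 𝓘(ℝ, V) (fun y : M => g • y)
      ((fun k : G => k • x) (g⁻¹ * 1 * g⁻¹⁻¹)) :=
    (contMDiff_const_smul_of_smul hsmul g).mdifferentiableAt (by simp)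
  have h2 := mfderiv_comp (1 : G) horb hconj
  have h3 := mfderiv_comp (1 : G) (g := fun y : M => g • y)
    (f := (fun k : G => k • x) ∘ fun k => g⁻¹ * k * g⁻¹⁻¹) hg
    (MDifferentiableAt.comp (1 : G) (g := fun k : G => k • x) (f := fun k => g⁻¹ * k * g⁻¹⁻¹)
      horb hconj)
  have e : (fun y : M => g • y) ∘ ((fun k : G => k • x) ∘ fun k => g⁻¹ * k * g⁻¹⁻¹) =
      fun k : G => k • g • x := by
    funext k
    simp [mul_smul]
  rw [e, h2] at h3
  -- the points at which the derivatives are taken simplify only propositionally, and their types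
  -- depend on them
  have e1 : ∀ k : G, k = 1 → (mfderiv 𝓘(ℝ, E) 𝓘(ℝ, V) (fun k : G => k • x) k : E →L[ℝ] V) =
      mfderiv 𝓘(ℝ, E) 𝓘(ℝ, V) (fun k : G => k • x) 1 := by
    rintro _ rfl
    rfl
  have e2 : ∀ y : M, y = x → (mfderiv 𝓘(ℝ, V) 𝓘(ℝ, V) (fun y : M => g • y) y : V →L[ℝ] V) =
      mfderiv 𝓘(ℝ, V) 𝓘(ℝ, V) (fun y : M => g • y) x := by
    rintro _ rfl
    rfl
  have e3 := e2 ((g⁻¹ * 1 * g⁻¹⁻¹) • x) (by rw [h1, one_smul])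
  have h4 : (fundamentalField (V := V) (g • x) Y : V) =
      (mfderiv 𝓘(ℝ, V) 𝓘(ℝ, V) (fun y : M => g • y) ((g⁻¹ * 1 * g⁻¹⁻¹) • x) : V →L[ℝ] V)
        ((mfderiv 𝓘(ℝ, E) 𝓘(ℝ, V) (fun k : G => k • x) (g⁻¹ * 1 * g⁻¹⁻¹) : E →L[ℝ] V)
          (lieAd g⁻¹ Y : E)) := congrArg (fun T : E →L[ℝ] V => T Y) h3
  rw [e3, e1 _ h1] at h4
  exact h4

/-- Equivariance of the moment map. -/
theorem momentMap_cotangentLift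
    (hsmul : ContMDiff (𝓘(ℝ, E).prod 𝓘(ℝ, V)) 𝓘(ℝ, V) ∞ (fun p : G × M => p.1 • p.2))
    (g : G) (p : CotangentBundle V M)
    (Y : GroupLieAlgebra 𝓘(ℝ, E) G) :
    momentMap (cotangentLift g p) Y = momentMap p (lieAd g⁻¹ Y) := by
  obtain ⟨h1, h2⟩ := inverse_mfderiv_smul (V := V) hsmul g p.1
  have h3 := fundamentalField_smul (V := V) hsmul g p.1 Y
  have h4 : momentMap (cotangentLift g p) Y =
      p.2 ((mfderiv 𝓘(ℝ, V) 𝓘(ℝ, V) (fun y : M => g • y) p.1 : V →L[ℝ] V).inverse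
        (fundamentalField (V := V) (g • p.1) Y : V) : V) := rfl
  rw [h4, h1, h3]
  exact congrArg p.2 (congrArg (fun T : V →L[ℝ] V => T (fundamentalField p.1 (lieAd g⁻¹ Y))) h2)

theorem continuous_momentMap
    (hsmul : ContMDiff (𝓘(ℝ, E).prod 𝓘(ℝ, V)) 𝓘(ℝ, V) ∞ (fun p : G × M => p.1 • p.2))
    [IsManifold 𝓘(ℝ, V) ∞ M]
    [RiemannianBundle (fun x : M => TangentSpace 𝓘(ℝ, V) x)]
    (Y : GroupLieAlgebra 𝓘(ℝ, E) G) :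
    Continuous fun p : CotangentBundle V M => momentMap p Y :=
  continuous_dual_apply (F := V) (E := fun x : M => TangentSpace 𝓘(ℝ, V) x)
    (continuous_fundamentalField hsmul Y)

end HomogeneousSpace

/-! ### One-parameter subgroups -/

section OneParameter

open Filter Topology

variable {E : Type*} [NormedAddCommGroup E] [NormedSpace ℝ E]
  {G : Type*} [TopologicalSpace G] [ChartedSpace E G] [Group G] [LieGroup 𝓘(ℝ, E) ∞ G]

/-- The derivative of `Ad (γ t)` at `t = 0` is `ad A`. -/
theorem IsOneParameterSubgroup.hasDerivAt_groupAd {A : GroupLieAlgebra 𝓘(ℝ, E) G} {γ : ℝ → G}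
    (hγ : IsOneParameterSubgroup A γ) :
    HasDerivAt (fun t => (groupAd (γ t) : E →L[ℝ] E)) (groupBracket E G A) 0 := by
  obtain ⟨h1, h2, -, h4⟩ := hγ
  have h5 : HasMFDerivAt 𝓘(ℝ, ℝ) 𝓘(ℝ, E) γ 0 (mfderiv 𝓘(ℝ, ℝ) 𝓘(ℝ, E) γ 0 : ℝ →L[ℝ] E) :=
    (h1.mdifferentiableAt (by simp)).hasMFDerivAt
  have h6 : HasMFDerivAt 𝓘(ℝ, E) 𝓘(ℝ, E) (extChartAt 𝓘(ℝ, E) (1 : G)) (γ 0)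
      (ContinuousLinearMap.id ℝ E) := by
    rw [h2]
    exact hasMFDerivAt_chart
  have h7 : HasFDerivAt (fun t => extChartAt 𝓘(ℝ, E) (1 : G) (γ t))
      (mfderiv 𝓘(ℝ, ℝ) 𝓘(ℝ, E) γ 0 : ℝ →L[ℝ] E) 0 :=
    hasMFDerivAt_iff_hasFDerivAt.1
      (HasMFDerivAt.comp (f := γ) (g := extChartAt 𝓘(ℝ, E) (1 : G)) 0 h6 h5)
  have h4' : (mfderiv 𝓘(ℝ, ℝ) 𝓘(ℝ, E) γ 0 : ℝ →L[ℝ] E) 1 = (A : E) := h4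
  have h8 : HasDerivAt (fun t => extChartAt 𝓘(ℝ, E) (1 : G) (γ t))
    ((mfderiv 𝓘(ℝ, ℝ) 𝓘(ℝ, E) γ 0 : ℝ →L[ℝ] E) 1) 0 := HasFDerivAt.hasDerivAt (F := E) h7
  rw [h4'] at h8
  have h9 : HasFDerivAt (fun x => (groupAd (chartInv E G x) : E →L[ℝ] E))
      (groupBracket E G) (extChartAt 𝓘(ℝ, E) (1 : G) (γ 0)) := by
    rw [h2]
    exact (contDiffAt_groupAd_chartInv.differentiableAt (by simp)).hasFDerivAt
  have h10 := h9.comp_hasDerivAt (0 : ℝ) h8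
  refine h10.congr_of_eventuallyEq ?_
  have h11 : ∀ᶠ t in 𝓝 (0 : ℝ), γ t ∈ (extChartAt 𝓘(ℝ, E) (1 : G)).source :=
    h1.continuous.continuousAt ((isOpen_extChartAt_source _).mem_nhds (by
      rw [h2]
      exact mem_extChartAt_source _))
  filter_upwards [h11] with t ht
  have h12 : chartInv E G (extChartAt 𝓘(ℝ, E) (1 : G) (γ t)) = γ t :=
    (extChartAt 𝓘(ℝ, E) (1 : G)).left_inv ht
  simp only [Function.comp_apply, h12]

/-- `Ad (γ t)` acts by `exp (t c)` on the `c`-eigenvectors of `ad A`. -/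
theorem IsOneParameterSubgroup.groupAd_apply {A : GroupLieAlgebra 𝓘(ℝ, E) G} {γ : ℝ → G}
    (hγ : IsOneParameterSubgroup A γ) {x : E} {c : ℝ} (hx : groupBracket E G A x = c • x) (t : ℝ) :
    (groupAd (γ t) : E →L[ℝ] E) x = Real.exp (t * c) • x := by
  have h0 : HasDerivAt (fun t => (groupAd (γ t) : E →L[ℝ] E) x) (c • x) 0 := by
    rw [← hx]
    exact (ContinuousLinearMap.apply ℝ E x).hasFDerivAt.comp_hasDerivAt 0 hγ.hasDerivAt_groupAd
  have h1 : ∀ t, HasDerivAt (fun t => (groupAd (γ t) : E →L[ℝ] E) x)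
      (c • (groupAd (γ t) : E →L[ℝ] E) x) t := fun t => by
    have h2 : HasDerivAt (fun s => (groupAd (γ (s - t)) : E →L[ℝ] E) x) (c • x) t := by
      have h3 : HasDerivAt (fun t => (groupAd (γ t) : E →L[ℝ] E) x) (c • x) (t - t) := by
        rwa [sub_self]
      exact h3.comp_sub_const t t
    have h4 := ((groupAd (γ t) : E →L[ℝ] E).hasFDerivAt.comp_hasDerivAt t h2)
    rw [map_smul] at h4
    refine h4.congr_of_eventuallyEq (Eventually.of_forall fun s => ?_)
    simp only [Function.comp_apply]
    rw [← groupAd_mul_apply, ← hγ.2.2.1, add_sub_cancel]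
  -- `e^{-tc} Ad(γ t) x` is constant
  have h5 : ∀ t, HasDerivAt (fun t => Real.exp (-(t * c)) • (groupAd (γ t) : E →L[ℝ] E) x) 0 t :=
    fun t => by
      have h6 : HasDerivAt (fun t => Real.exp (-(t * c))) (Real.exp (-(t * c)) * -c) t := by
        have := ((hasDerivAt_id t).mul_const c).neg.exp
        simpa using this
      refine (h6.smul (h1 t)).congr_deriv ?_
      rw [smul_smul, ← add_smul]
      simp
  have h7 := is_const_of_deriv_eq_zero (fun t => (h5 t).differentiableAt) (fun t => (h5 t).deriv)
    t 0
  simp only [hγ.2.1, groupAd_one, zero_mul, neg_zero, Real.exp_zero, one_smul] at h7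
  have h8 := congrArg (fun y => Real.exp (t * c) • y) h7
  simp only [smul_smul, ← Real.exp_add, add_neg_cancel, Real.exp_zero, one_smul] at h8
  exact h8

/-- `Ad (exp A)⁻¹` acts on the `c`-eigenvectors of `ad A` by `exp (-s c)`, with `s = 1` if there is a
one-parameter group with velocity `A`. Such a group always exists, but this is not needed: without
it `lieExp A = 1`, which is the case `s = 0`. -/
theorem exists_lieAd_inv_lieExp [CompleteSpace E] (A : GroupLieAlgebra 𝓘(ℝ, E) G) :
    ∃ s : ℝ, 0 ≤ s ∧ ∀ (X : GroupLieAlgebra 𝓘(ℝ, E) G) (c : ℝ), ⁅A, X⁆ = c • X →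
      lieAd (lieExp A)⁻¹ X = Real.exp (-(s * c)) • X := by
  by_cases h : ∃ γ : ℝ → G, IsOneParameterSubgroup A γ
  · have h2 : lieExp A = h.choose 1 := dif_pos h
    have key : ∀ (x : E) (c : ℝ), groupBracket E G (A : E) x = c • x →
        (groupAd (lieExp A)⁻¹ : E →L[ℝ] E) x = Real.exp (-(1 * c)) • x := fun x c hx => by
      have h1 := h.choose_spec.groupAd_apply hx 1
      rw [← h2] at h1
      have h3 := groupAd_inv_apply_self (E := E) (lieExp A) x
      rw [h1, map_smul] at h3
      have h4 := congrArg (fun y => Real.exp (-(1 * c)) • y) h3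
      simp only [smul_smul, ← Real.exp_add, neg_add_cancel, Real.exp_zero, one_smul] at h4
      exact h4
    exact ⟨1, zero_le_one, fun X c hX => key X c ((groupBracket_apply A X).trans hX)⟩
  · refine ⟨0, le_rfl, fun X c _ => ?_⟩
    have h2 : lieExp A = 1 := dif_neg h
    rw [h2, inv_one, lieAd_one]
    simp

end OneParameter

/-! ### Invariant conic neighbourhoods of `Σ_s` -/

section ConicNeighbourhoods

open Filter Topology

theorem norm_pos_of_ne_zero {W : Type*} [NormedAddCommGroup W] [NormedSpace ℝ W]
    {ξ : W →L[ℝ] ℝ} (h : ξ ≠ 0) : 0 < ‖ξ‖ := norm_pos_iff.2 h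

theorem ne_zero_of_norm_eq_one {W : Type*} [NormedAddCommGroup W] [NormedSpace ℝ W]
    {ξ : W →L[ℝ] ℝ} (h : ‖ξ‖ = 1) : ξ ≠ 0 := fun h0 => by
  rw [h0, norm_zero] at h
  exact zero_ne_one h

theorem norm_normalize_of_ne_zero {W : Type*} [NormedAddCommGroup W] [NormedSpace ℝ W]
    {ξ : W →L[ℝ] ℝ} (h : ξ ≠ 0) : ‖‖ξ‖⁻¹ • ξ‖ = 1 := by
  rw [norm_smul, norm_inv, norm_norm, inv_mul_cancel₀ (norm_pos_of_ne_zero h).ne']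

theorem IsCompact.exists_mul_le {X : Type*} [TopologicalSpace X] {K : Set X} (hK : IsCompact K)
    {f g : X → ℝ} (hf : ContinuousOn f K) (hg : ContinuousOn g K) (hpos : ∀ x ∈ K, 0 < f x)
    (hg0 : ∀ x ∈ K, 0 ≤ g x) : ∃ δ : ℝ, 0 < δ ∧ ∀ x ∈ K, δ * g x ≤ f x := by
  rcases K.eq_empty_or_nonempty with rfl | hne
  · exact ⟨1, one_pos, by simp⟩
  obtain ⟨x₀, hx₀, hmin⟩ := hK.exists_isMinOn hne hf
  obtain ⟨x₁, hx₁, hmax⟩ := hK.exists_isMaxOn hne hg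
  have h1 := hpos x₀ hx₀
  have h2 := hg0 x₁ hx₁
  refine ⟨f x₀ / (g x₁ + 1), by positivity, fun x hx => ?_⟩
  have h3 : g x ≤ g x₁ + 1 := (hmax hx).trans (by linarith)
  calc f x₀ / (g x₁ + 1) * g x ≤ f x₀ / (g x₁ + 1) * (g x₁ + 1) := by gcongr
    _ = f x₀ := div_mul_cancel₀ _ (by positivity)
    _ ≤ f x := hmin hx

variable {E : Type*} [NormedAddCommGroup E] [NormedSpace ℝ E] [CompleteSpace E]
  {G : Type*} [TopologicalSpace G] [ChartedSpace E G] [Group G] [LieGroup 𝓘(ℝ, E) ∞ G]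
  {V : Type*} [NormedAddCommGroup V] [NormedSpace ℝ V]
  {M : Type*} [TopologicalSpace M] [ChartedSpace V M] [MulAction G M]
  {D : IwasawaData (GroupLieAlgebra 𝓘(ℝ, E) G)}
  {n : ℕ} {b : Module.Basis (Fin n) ℝ (GroupLieAlgebra 𝓘(ℝ, E) G)}
  {α : Fin n → Module.Dual ℝ D.𝔞}

/-- A linear form vanishes on `𝔫⁺` as soon as it vanishes on the positive root vectors of a root
basis. -/
theorem eq_zero_of_mem_nPlus (hb : ∀ j, b j ∈ D.rootSpace (α j))
    {f : GroupLieAlgebra 𝓘(ℝ, E) G →ₗ[ℝ] ℝ} (hf : ∀ j, α j ∈ D.posRoots → f (b j) = 0)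
    {X : GroupLieAlgebra 𝓘(ℝ, E) G} (hX : X ∈ D.nPlus) : f X = 0 := by
  suffices h : D.nPlus ≤ LinearMap.ker f from h hX
  refine iSup₂_le fun β hβ Y hY => ?_
  rw [LinearMap.mem_ker, ← b.sum_repr Y, map_sum]
  refine Finset.sum_eq_zero fun j _ => ?_
  rw [map_smul, smul_eq_mul]
  by_cases hj : b.repr Y j = 0
  · rw [hj, zero_mul]
  · have hαβ : α j = β := by
      ext H
      have h1 : ∑ i, (b.repr Y i * (α i H - β H)) • b i = 0 := by
        have h2 := hY H
        conv_lhs at h2 => rw [← b.sum_repr Y]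
        conv_rhs at h2 => rw [← b.sum_repr Y]
        rw [lie_sum, Finset.smul_sum, ← sub_eq_zero, ← Finset.sum_sub_distrib] at h2
        rw [← h2]
        refine Finset.sum_congr rfl fun i _ => ?_
        rw [lie_smul, hb i H, smul_smul, smul_smul, ← sub_smul]
        congr 1
        ring
      have h3 := Fintype.linearIndependent_iff.1 b.linearIndependent _ h1 j
      exact sub_eq_zero.1 ((mul_eq_zero.1 h3).resolve_left hj)
    rw [hf j (hαβ ▸ hβ), mul_zero]

variable (V M b α) in
open Classical in
/-- The sum of squares of the components of the moment map along the root vectors of the basis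
whose root satisfies `P`. -/
def rootEnergy (P : Module.Dual ℝ D.𝔞 → Prop) (p : CotangentBundle V M) : ℝ :=
  ∑ j, if P (α j) then momentMap p (b j) ^ 2 else 0

open Classical in
theorem rootEnergy_nonneg (P : Module.Dual ℝ D.𝔞 → Prop) (p : CotangentBundle V M) :
    0 ≤ rootEnergy V M b α P p :=
  Finset.sum_nonneg fun j _ => by split_ifs <;> positivity

theorem rootEnergy_eq_zero {P : Module.Dual ℝ D.𝔞 → Prop} {p : CotangentBundle V M} :
    rootEnergy V M b α P p = 0 ↔ ∀ j, P (α j) → momentMap p (b j) = 0 := by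
  classical
  rw [rootEnergy, Finset.sum_eq_zero_iff_of_nonneg fun j _ => by split_ifs <;> positivity]
  refine forall_congr' fun j => ?_
  by_cases h : P (α j) <;> simp [h]

theorem rootEnergy_smul (P : Module.Dual ℝ D.𝔞 → Prop) (p : CotangentBundle V M) (r : ℝ) :
    rootEnergy V M b α P ⟨p.1, r • p.2⟩ = r ^ 2 * rootEnergy V M b α P p := by
  classical
  rw [rootEnergy, rootEnergy, Finset.mul_sum]
  refine Finset.sum_congr rfl fun j _ => ?_
  have h : momentMap (⟨p.1, r • p.2⟩ : CotangentBundle V M) (b j) = r * momentMap p (b j) := rfl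
  split_ifs
  · rw [h, mul_pow]
  · rw [mul_zero]

theorem continuous_rootEnergy
    (hsmul : ContMDiff (𝓘(ℝ, E).prod 𝓘(ℝ, V)) 𝓘(ℝ, V) ∞ (fun p : G × M => p.1 • p.2))
    [IsManifold 𝓘(ℝ, V) ∞ M] [Bundle.RiemannianBundle (fun x : M => TangentSpace 𝓘(ℝ, V) x)]
    (P : Module.Dual ℝ D.𝔞 → Prop) : Continuous (rootEnergy V M b α P) := by
  classical
  refine continuous_finsetSum _ fun j _ => ?_
  by_cases h : P (α j)
  · simp only [if_pos h]
    exact (continuous_momentMap hsmul (b j)).pow 2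
  · simp only [if_neg h]
    exact continuous_const

/-- The lifted action of `exp A`, `A` in the closed positive chamber, does not increase the
positive components of the moment map, and does not decrease the others. -/
theorem rootEnergy_cotangentLift_lieExp (hb : ∀ j, b j ∈ D.rootSpace (α j))
    (hsmul : ContMDiff (𝓘(ℝ, E).prod 𝓘(ℝ, V)) 𝓘(ℝ, V) ∞ (fun p : G × M => p.1 • p.2))
    {A : D.𝔞} (hA : A ∈ D.weylChamber) {t : ℝ} (ht : 0 ≤ t) (p : CotangentBundle V M) :
    rootEnergy V M b α (· ∈ D.posRoots)
        (cotangentLift (lieExp (t • (A : GroupLieAlgebra 𝓘(ℝ, E) G))) p) ≤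
      rootEnergy V M b α (· ∈ D.posRoots) p ∧
    rootEnergy V M b α (· ∉ D.posRoots) p ≤
      rootEnergy V M b α (· ∉ D.posRoots)
        (cotangentLift (lieExp (t • (A : GroupLieAlgebra 𝓘(ℝ, E) G))) p) := by
  classical
  obtain ⟨s, hs, h⟩ := exists_lieAd_inv_lieExp (t • (A : GroupLieAlgebra 𝓘(ℝ, E) G))
  set g := lieExp (t • (A : GroupLieAlgebra 𝓘(ℝ, E) G))
  have hμ : ∀ j, momentMap (cotangentLift g p) (b j) =
      Real.exp (-(s * (t * α j A))) * momentMap p (b j) := fun j => by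
    rw [momentMap_cotangentLift hsmul, h (b j) (t * α j A) (by
      rw [smul_lie, hb j A, smul_smul]), map_smul, smul_eq_mul]
  constructor
  · refine Finset.sum_le_sum fun j _ => ?_
    split_ifs with hj
    · rw [hμ, mul_pow]
      refine mul_le_of_le_one_left (sq_nonneg _) (pow_le_one₀ (Real.exp_pos _).le ?_)
      exact Real.exp_le_one_iff.2 (neg_nonpos.2 (mul_nonneg hs (mul_nonneg ht (hA _ hj))))
    · exact le_rfl
  · refine Finset.sum_le_sum fun j _ => ?_
    split_ifs with hj
    · rw [hμ, mul_pow]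
      have h1 : α j A ≤ 0 := D.apply_nonpos_of_notMem_posRoots
        ((Submodule.ne_bot_iff _).2 ⟨b j, hb j, b.ne_zero j⟩) hj hA
      refine le_mul_of_one_le_left (sq_nonneg _) (one_le_pow₀ (Real.one_le_exp ?_))
      exact neg_nonneg.2 (mul_nonpos_of_nonneg_of_nonpos hs
        (mul_nonpos_of_nonneg_of_nonpos ht h1))
    · exact le_rfl

/-- `Σ_s` is the set on which the positive components of the moment map vanish. -/
theorem mem_sigmaS_iff [Bundle.RiemannianBundle (fun x : M => TangentSpace 𝓘(ℝ, V) x)]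
    (hb : ∀ j, b j ∈ D.rootSpace (α j)) {p : cosphereBundle V M} :
    p ∈ sigmaS V D M ↔ rootEnergy V M b α (· ∈ D.posRoots) p.1 = 0 := by
  rw [rootEnergy_eq_zero]
  constructor
  · intro h j hj
    exact h _ ⟨b j, Submodule.mem_iSup_of_mem _ (Submodule.mem_iSup_of_mem hj (hb j)), rfl⟩
  · rintro h _ ⟨X, hX, rfl⟩
    exact eq_zero_of_mem_nPlus hb h hX

/-- On a homogeneous space the moment map has no zeros outside the zero section. -/
theorem rootEnergy_pos
    (hff : ∀ x : M, Function.Surjective (fundamentalField (E := E) (G := G) (V := V) x))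
    {p : CotangentBundle V M} (hp : p.2 ≠ 0)
    (h : rootEnergy V M b α (· ∈ D.posRoots) p = 0) :
    0 < rootEnergy V M b α (· ∉ D.posRoots) p := by
  refine (rootEnergy_nonneg _ p).lt_of_ne' fun h' => hp ?_
  rw [rootEnergy_eq_zero] at h h'
  have h0 : momentMap (E := E) (G := G) p = 0 := b.ext fun j => by
    by_cases hj : α j ∈ D.posRoots
    · exact h j hj
    · exact h' j hj
  refine ContinuousLinearMap.ext fun v => ?_
  obtain ⟨Y, rfl⟩ := hff p.1 v
  exact congrArg (fun f => f Y) h0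

/-- For `δ > 0`, the set of covectors whose positive components are small compared with the others
is positively invariant under the flows of the positive chamber. -/
theorem isPositivelyInvariant_rootEnergy_lt
    [Bundle.RiemannianBundle (fun x : M => TangentSpace 𝓘(ℝ, V) x)]
    (hb : ∀ j, b j ∈ D.rootSpace (α j))
    (hsmul : ContMDiff (𝓘(ℝ, E).prod 𝓘(ℝ, V)) 𝓘(ℝ, V) ∞ (fun p : G × M => p.1 • p.2))
    {δ : ℝ} (hδ : 0 < δ) {A : D.𝔞} (hA : A ∈ D.weylChamber) :
    IsPositivelyInvariant D A {p : cosphereBundle V M |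
      rootEnergy V M b α (· ∈ D.posRoots) p.1 < δ * rootEnergy V M b α (· ∉ D.posRoots) p.1} := by
  rintro t ht _ ⟨p, hp, rfl⟩
  obtain ⟨h1, h2⟩ := rootEnergy_cotangentLift_lieExp hb hsmul hA ht p.1
  set q := cotangentLift (lieExp (t • (A : GroupLieAlgebra 𝓘(ℝ, E) G))) p.1 with hq
  have hlt : rootEnergy V M b α (· ∈ D.posRoots) q <
      δ * rootEnergy V M b α (· ∉ D.posRoots) q :=
    h1.trans_lt (hp.trans_le (mul_le_mul_of_nonneg_left h2 hδ.le))
  have hq0 : q.2 ≠ 0 := fun h0 => by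
    have h3 : rootEnergy V M b α (· ∉ D.posRoots) q = 0 := rootEnergy_eq_zero.2 fun j _ => by
      rw [momentMap_apply, h0]
      rfl
    rw [h3, mul_zero] at hlt
    exact hlt.not_ge (rootEnergy_nonneg _ q)
  have hn := norm_pos_of_ne_zero (W := TangentSpace 𝓘(ℝ, V) q.1) hq0
  refine ⟨⟨⟨q.1, ‖q.2‖⁻¹ • q.2⟩, ?_⟩, ?_, rfl⟩
  · change ‖‖q.2‖⁻¹ • q.2‖ = 1
    exact norm_normalize_of_ne_zero (W := TangentSpace 𝓘(ℝ, V) q.1) hq0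
  · change rootEnergy V M b α (· ∈ D.posRoots) ⟨q.1, ‖q.2‖⁻¹ • q.2⟩ <
      δ * rootEnergy V M b α (· ∉ D.posRoots) ⟨q.1, ‖q.2‖⁻¹ • q.2⟩
    rw [rootEnergy_smul, rootEnergy_smul, mul_left_comm]
    exact mul_lt_mul_of_pos_left hlt (by positivity)

end ConicNeighbourhoods

end

theorem mainTheorem4
    {E : Type*} [NormedAddCommGroup E] [NormedSpace ℝ E] [FiniteDimensional ℝ E] [CompleteSpace E]
    -- a real semisimple Lie group with its standard data
    {G : Type*} [TopologicalSpace G] [ChartedSpace E G] [Group G] [LieGroup 𝓘(ℝ, E) ∞ G]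
    [T2Space G] [SecondCountableTopology G]
    [LieAlgebra.IsSemisimple ℝ (GroupLieAlgebra 𝓘(ℝ, E) G)]
    (D : IwasawaData (GroupLieAlgebra 𝓘(ℝ, E) G))
    (C : Set D.𝔞) (hC : D.roots ⊆ D.rootsZero C ∪ D.rootsPos C ∪ D.rootsNeg C)
    -- the smooth structure of the homogeneous space `F_C = G / P_C` : the unique one for which the
    -- projection is a smooth submersion
    {V : Type*} [NormedAddCommGroup V] [NormedSpace ℝ V] [FiniteDimensional ℝ V]
    [ChartedSpace V (FlagManifold D C)] [IsManifold 𝓘(ℝ, V) ∞ (FlagManifold D C)]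
    (hproj : Manifold.IsSubmersion 𝓘(ℝ, E) 𝓘(ℝ, V) ∞ (fun g : G => (g : FlagManifold D C)))
    -- a Riemannian metric on `F_C`
    [Bundle.RiemannianBundle (fun x : FlagManifold D C => TangentSpace 𝓘(ℝ, V) x)]
    [IsContMDiffRiemannianBundle 𝓘(ℝ, V) ∞ V
      (fun x : FlagManifold D C => TangentSpace 𝓘(ℝ, V) x)]
    (V₀ : Set (cosphereBundle V (FlagManifold D C))) (hV₀ : IsOpen V₀)
    (hSigma : sigmaS V D (FlagManifold D C) ⊆ V₀) :
    ∃ V' : Set (cosphereBundle V (FlagManifold D C)),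
      IsOpen V' ∧ sigmaS V D (FlagManifold D C) ⊆ V' ∧ V' ⊆ V₀ ∧
        ∀ A ∈ D.weylChamber, IsPositivelyInvariant D A V' := by
  obtain ⟨n, b, α, hb⟩ := D.exists_rootBasis
  have hsurj : Function.Surjective (fun g : G => (g : FlagManifold D C)) :=
    QuotientGroup.mk_surjective
  have hequiv : ∀ g h : G, ((g * h : G) : FlagManifold D C) = g • (h : FlagManifold D C) :=
    fun _ _ => rfl
  have hsmul := contMDiff_smul_of_submersion hsurj hequiv hproj
  have hff := surjective_fundamentalField_of_submersion hsurj hequiv hproj hsmul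
  have _ : CompactSpace (FlagManifold D C) := compactSpace_flagManifold D C hC
  have _ : CompactSpace (cosphereBundle V (FlagManifold D C)) :=
    isCompact_iff_compactSpace.1 isCompact_cosphereBundle
  have hcont : ∀ P : Module.Dual ℝ D.𝔞 → Prop,
      Continuous fun p : cosphereBundle V (FlagManifold D C) =>
        rootEnergy V (FlagManifold D C) b α P p.1 :=
    fun P => (continuous_rootEnergy hsmul P).comp continuous_subtype_val
  -- the positive energy has a positive minimum on the compact complement of `V₀`, as it vanishes
  -- only on `Σ_s`
  obtain ⟨δ, hδ, hδ'⟩ := hV₀.isClosed_compl.isCompact.exists_mul_le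
    (hcont (· ∈ D.posRoots)).continuousOn (hcont (· ∉ D.posRoots)).continuousOn
    (fun p hp => (rootEnergy_nonneg _ p.1).lt_of_ne' fun h =>
      hp (hSigma ((mem_sigmaS_iff hb).2 h)))
    (fun p _ => rootEnergy_nonneg _ p.1)
  refine ⟨{p | rootEnergy V (FlagManifold D C) b α (· ∈ D.posRoots) p.1 <
    δ * rootEnergy V (FlagManifold D C) b α (· ∉ D.posRoots) p.1},
    isOpen_lt (hcont _) (continuous_const.mul (hcont _)), fun p hp => ?_, fun p hp => ?_,
    fun A hA => isPositivelyInvariant_rootEnergy_lt hb hsmul hδ hA⟩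
  · have h0 := (mem_sigmaS_iff hb).1 hp
    have hp1 : p.1.2 ≠ 0 := ne_zero_of_norm_eq_one (W := TangentSpace 𝓘(ℝ, V) p.1.1) p.2
    change rootEnergy V (FlagManifold D C) b α _ p.1 < _
    rw [h0]
    exact mul_pos hδ (rootEnergy_pos hff hp1 h0)
  · by_contra hpV
    exact (hδ' p hpV).not_gt hp
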